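/- **Model.** Consider $n$ queues in discrete time and a finite set $\mathcal T$ of channel states with probability mass function $\psi$. For each $t\in\mathcal T$ let $\mathcal S^{(t)}\subset\mathbb N^n$ be a finite nonempty set of feasible service vectors that contains, with each $x$, the projections of $x$ on the coordinate axes. In slot $k$ the vector of queue lengths $q(k)\in\mathbb N^n$ is observed, a channel state $T(k)$ is realized, a MaxWeight schedule $s(k)\in\arg\max_{x\in\mathcal S^{(T(k))}}\langle x,q(k)\rangle$ is selected, arrivals $a(k)\in\mathbb N^n$ occur, and $q_i(k+1)=\max\{q_i(k)+a_i(k)-s_i(k),0\}$. The vectors $a(k)$ are i.i.d. in $k$ (their components may be correlated), the $T(k)$ are i.i.d. with law $\psi$, ties in the argmax are broken by a fixed rule depending on $q(k)$, $T(k)$ and an i.i.d. randomization, and the arrivals, the channel states, this randomization and the initial queue lengths are mutually independent. The capacity region is the polytope $\mathcal C=\sum_{t\in\mathcal T}\psi_t\,\mathrm{ConvexHull}(\mathcal S^{(t)})$ (a Minkowski sum). Let $\mathcal F^{(\ell)}=\{x\in\mathcal C:\langle c^{(\ell)},x\rangle=b^{(\ell)}\}$ be a facet of $\mathcal C$ (of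 dimension $n-1$), where $\langle c^{(\ell)},x\rangle\le b^{(\ell)}$ for all $x\in\mathcal C$, $c^{(\ell)}\ge 0$, $\|c^{(\ell)}\|=1$ and $b^{(\ell)}>0$. Let $B_\ell$ be a random variable that takes the value $b^{(t,\ell)}=\max_{s\in\mathcal S^{(t)}}\langle c^{(\ell)},s\rangle$ with probability $\psi_t$, and let $\sigma^2_{B_\ell}=\mathrm{Var}(B_\ell)$. **Theorem.** Let $r^{(\ell)}$ be in the relative interior of $\mathcal F^{(\ell)}$ and let $\varepsilon_0>0$. For each $\varepsilon\in(0,\varepsilon_0)$ consider such a switch (with the same $\psi$ and $\mathcal S^{(t)}$) operating under MaxWeight, with arrivals $a^{(\varepsilon)}(k)$ of mean $\mathbb E[a^{(\varepsilon)}(k)]=r^{(\ell)}-\varepsilon c^{(\ell)}$, and suppose that there is a constant $A_{\max}$, independent of $\varepsilon$, with $a^{(\varepsilon)}_i(k)\le A_{\max}$ almost surely for all $i$ and $k$. Suppose that for each $\varepsilon$ the queue length process $\{q^{(\varepsilon)}(k)\}$ converges in distribution, as $k\to\infty$, to a (steady-state) random vector $\bar q^{(\varepsilon)}$, and that $\lim_{\varepsilon\downarrow0}\mathrm{Cov}[a_i^{(\varepsilon)},a_j^{(\varepsilon)}]=\mathrm{Cov}[a_i,a_j]$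 exists for all $i,j$. Then $\varepsilon\bar q^{(\varepsilon)}$ converges in distribution to $\Upsilon c^{(\ell)}$ as $\varepsilon\downarrow 0$, where $\Upsilon$ is an exponential random variable with mean $$\frac12\Big(\sum_{i=1}^n\sum_{j=1}^n c_i^{(\ell)}c_j^{(\ell)}\,\mathrm{Cov}[a_i,a_j]+\sigma^2_{B_\ell}\Big)$$ (if this mean is $0$, then $\Upsilon=0$ almost surely). -/

import Mathlib

open MeasureTheory ProbabilityTheory Filter Topology
open scoped Pointwise RealInnerProductSpace

/-- The data of a generalized switch with `n` queues: a finite set `𝒯` of channel states with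
probability mass function `ψ`, and for every channel state a finite nonempty set of feasible
service vectors (numbers of jobs) that contains, with each of its elements, the projections of that
element on the coordinate axes. -/
structure GeneralizedSwitch (n : ℕ) (𝒯 : Type*) where
  /-- the law of the channel state in one time slot -/
  ψ : PMF 𝒯
  /-- the feasible service vectors in each channel state -/
  S : 𝒯 → Finset (Fin n → ℕ)
  S_nonempty : ∀ t, (S t).Nonempty
  single_mem : ∀ t, ∀ x ∈ S t, ∀ i, Pi.single i (x i) ∈ S t

/-- A vector of natural numbers, seen in Euclidean space. -/
def natVec {n : ℕ} (x : Fin n → ℕ) : EuclideanSpace ℝ (Fin n) :=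
  WithLp.toLp 2 (fun i => (x i : ℝ))

namespace GeneralizedSwitch

variable {n : ℕ} {𝒯 : Type*} (G : GeneralizedSwitch n 𝒯)

/-- The capacity region: the Minkowski sum `∑ t, ψ t • ConvexHull (S t)`. -/
def capacityRegion [Fintype 𝒯] : Set (EuclideanSpace ℝ (Fin n)) :=
  ∑ t, (G.ψ t).toReal • convexHull ℝ (natVec '' (G.S t : Set (Fin n → ℕ)))

/-- The schedules that MaxWeight may select in channel state `t` with queue lengths `q`: the
maximizers of `⟨x, q⟩` over `x ∈ S t`. -/
def maxWeightSet (q : Fin n → ℕ) (t : 𝒯) : Set (Fin n → ℕ) :=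
  {x | x ∈ G.S t ∧ ∀ y ∈ G.S t, ∑ i, y i * q i ≤ ∑ i, x i * q i}

/-- The maximum `c`-weighted service rate `max {⟨c, s⟩ : s ∈ S t}` available in channel state `t`. -/
noncomputable def maxRate (c : EuclideanSpace ℝ (Fin n)) (t : 𝒯) : ℝ :=
  (G.S t).sup' (G.S_nonempty t) (fun s => ⟪c, natVec s⟫)

/-- The variance of the random variable `B` that equals `maxRate c t` with probability `ψ t`. -/
noncomputable def maxRateVariance [MeasurableSpace 𝒯] (c : EuclideanSpace ℝ (Fin n)) : ℝ :=
  Var[G.maxRate c; G.ψ.toMeasure]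

/-- The queue length process of the generalized switch `G` operated under MaxWeight, on a
probability space `(Ω, P)`. In slot `k` the queue lengths `queue k` are observed, the channel state
`channel k` is realized, a MaxWeight schedule is selected (ties are broken by a fixed rule that may
use the random number `seed k`), and `arrival k` is the vector of arrivals. The arrival vectors,
the channel states and the seeds are i.i.d. over time; the components of one arrival vector may be
correlated. -/
structure MaxWeightSystem [MeasurableSpace 𝒯] {Ω : Type*} [MeasurableSpace Ω]
    (P : Measure Ω) where
  arrival : ℕ → Ω → Fin n → ℕ
  channel : ℕ → Ω → 𝒯
  seed : ℕ → Ω → ℝ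
  /-- the rule that selects the schedule from queue lengths, channel state and seed -/
  select : (Fin n → ℕ) → 𝒯 → ℝ → Fin n → ℕ
  queue : ℕ → Ω → Fin n → ℕ
  measurable_arrival : ∀ k, Measurable (arrival k)
  measurable_channel : ∀ k, Measurable (channel k)
  measurable_seed : ∀ k, Measurable (seed k)
  measurable_select : ∀ q t, Measurable (select q t)
  measurable_queue_zero : Measurable (queue 0)
  arrival_indep : iIndepFun arrival P
  arrival_identDistrib : ∀ k, IdentDistrib (arrival k) (arrival 0) P P
  channel_indep : iIndepFun channel P
  channel_law : ∀ k, HasLaw (channel k) G.ψ.toMeasure P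
  seed_indep : iIndepFun seed P
  seed_identDistrib : ∀ k, IdentDistrib (seed k) (seed 0) P P
  /- The next three fields: the arrival process, the channel process, the seeds and the initial
  queue lengths are mutually independent. -/
  arrival_indep_rest : IndepFun (fun ω k => arrival k ω)
    (fun ω => ((fun k => channel k ω), (fun k => seed k ω), queue 0 ω)) P
  channel_indep_rest : IndepFun (fun ω k => channel k ω)
    (fun ω => ((fun k => seed k ω), queue 0 ω)) P
  seed_indep_queue_zero : IndepFun (fun ω k => seed k ω) (queue 0) P
  select_mem : ∀ q t u, select q t u ∈ G.maxWeightSet q t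
  /-- `q(k+1) = max (q(k) + a(k) - s(k), 0)`, by truncated subtraction in `ℕ` -/
  queue_succ : ∀ k ω i, queue (k + 1) ω i =
    queue k ω i + arrival k ω i - select (queue k ω) (channel k ω) (seed k ω) i

end GeneralizedSwitch

/-- The face of `C` on the hyperplane `⟨c, x⟩ = b`. -/
def faceOf {n : ℕ} (C : Set (EuclideanSpace ℝ (Fin n))) (c : EuclideanSpace ℝ (Fin n)) (b : ℝ) :
    Set (EuclideanSpace ℝ (Fin n)) :=
  {x ∈ C | ⟪c, x⟫ = b}

/-- `⟨c, x⟩ ≤ b` is a normalized facet-defining inequality of `C`: it is valid on `C`, its face has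
affine dimension `n - 1`, and `c ≥ 0`, `‖c‖ = 1`, `b > 0`. -/
structure IsFacetInequality {n : ℕ} (C : Set (EuclideanSpace ℝ (Fin n)))
    (c : EuclideanSpace ℝ (Fin n)) (b : ℝ) : Prop where
  nonneg : ∀ i, 0 ≤ c i
  norm_eq_one : ‖c‖ = 1
  pos : 0 < b
  valid : ∀ x ∈ C, ⟪c, x⟫ ≤ b
  codim_one : Module.finrank ℝ (vectorSpan ℝ (faceOf C c b)) + 1 = n

/-- The exponential distribution with mean `m`; for `m = 0` this is the point mass at `0`. -/
noncomputable def exponentialWithMean (m : ℝ) : Measure ℝ :=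
  if m = 0 then Measure.dirac 0 else expMeasure m⁻¹

/-! Write y = ⟨c, q⟩ and let w be the norm of the component of q orthogonal to c. Two facts give the
theorem: w has a second moment bounded uniformly in ε, and the characteristic function of εy nearly
satisfies the equation that determines the exponential law.

Since the inputs of a slot are independent of the current queue lengths and the state space is
discrete, a limit law of the queue lengths is stationary (`stationary`).

State space collapse: r lies in the relative interior of a facet, so the support function h of the
capacity region satisfies ⟨v, r⟩ + δ‖perp c v‖ ≤ h(v) (`exists_inner_add_le_meanMaxRate`). MaxWeight
attains h(q) in the mean, so w has negative drift when it is large. The shift -εc of the arrival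
rate is orthogonal to the component that matters, and the drift does not depend on ε. Foster's
criterion (`lintegral_le_of_drift`) with the function w⁴ bounds E w² (`lintegral_norm_perp_sq_le`).

Transform: y' = y + z + d + v. Here z is the weighted arrivals minus the best weighted service rate,
independent of q with mean -ε; d ≥ 0 is the rate that MaxWeight gives up; v ≥ 0 is the unused
service. Stationarity forces E(d + v) = ε. Moreover d and v can be nonzero only near y = 0 relative
to w: y d ≤ K w d (`inner_mul_maxRate_sub_le`) and y' v ≤ K w' v (`inner_next_mul_unused_le`). Hence
in the second-order expansion of exp(iθεy') the factors multiplying d and v may be replaced by 1.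
With g = E exp(iθεy) this gives g (iθ + θ² E z² / 2) = iθ + O(√ε) (`norm_transform_le`), and E z²
tends to twice the claimed mean. The solution of the limit equation is the exponential
characteristic function.

Finally εq differs from εy c by a vector of norm εw, which is negligible, and Lévy's theorem
concludes. -/

set_option linter.unusedSectionVars false

/-! ### Independence -/

section Independence

variable {Ω α₁ α₂ β₁ β₂ : Type*} [MeasurableSpace Ω] [MeasurableSpace α₁] [MeasurableSpace α₂]
  [MeasurableSpace β₁] [MeasurableSpace β₂] {P : Measure Ω} [IsProbabilityMeasure P]

lemma measurePreserving_prodProdProdComm (μ₁ : Measure α₁) (μ₂ : Measure α₂) (ν₁ : Measure β₁)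
    (ν₂ : Measure β₂) [SFinite μ₁] [SFinite μ₂] [SFinite ν₁] [SFinite ν₂] :
    MeasurePreserving (fun p : (α₁ × α₂) × β₁ × β₂ => ((p.1.1, p.2.1), (p.1.2, p.2.2)))
      ((μ₁.prod μ₂).prod (ν₁.prod ν₂)) ((μ₁.prod ν₁).prod (μ₂.prod ν₂)) := by
  have h1 := measurePreserving_prodAssoc μ₁ μ₂ (ν₁.prod ν₂)
  have h2 := (MeasurePreserving.id μ₁).prod ((measurePreserving_prodAssoc μ₂ ν₁ ν₂).symm)
  have h3 := (MeasurePreserving.id μ₁).prod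
    ((Measure.measurePreserving_swap (μ := μ₂) (ν := ν₁)).prod (MeasurePreserving.id ν₂))
  have h4 := (MeasurePreserving.id μ₁).prod (measurePreserving_prodAssoc ν₁ μ₂ ν₂)
  have h5 := (measurePreserving_prodAssoc μ₁ ν₁ (μ₂.prod ν₂)).symm
  exact h5.comp (h4.comp (h3.comp (h2.comp h1)))

/-- Two independent pairs with independent entries can be regrouped. -/
lemma ProbabilityTheory.IndepFun.regroup {X₁ : Ω → α₁} {X₂ : Ω → α₂} {Y₁ : Ω → β₁} {Y₂ : Ω → β₂}
    (mX₁ : Measurable X₁) (mX₂ : Measurable X₂) (mY₁ : Measurable Y₁) (mY₂ : Measurable Y₂)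
    (h : IndepFun (fun ω => (X₁ ω, X₂ ω)) (fun ω => (Y₁ ω, Y₂ ω)) P)
    (hX : IndepFun X₁ X₂ P) (hY : IndepFun Y₁ Y₂ P) :
    IndepFun (fun ω => (X₁ ω, Y₁ ω)) (fun ω => (X₂ ω, Y₂ ω)) P := by
  have e := h.map_prod_eq_prod_map_map (by fun_prop) (by fun_prop)
  rw [hX.map_prod_eq_prod_map_map (by fun_prop) (by fun_prop),
    hY.map_prod_eq_prod_map_map (by fun_prop) (by fun_prop)] at e
  have h₁ : IndepFun X₁ Y₁ P := h.comp measurable_fst measurable_fst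
  have h₂ : IndepFun X₂ Y₂ P := h.comp measurable_snd measurable_snd
  rw [indepFun_iff_map_prod_eq_prod_map_map (by fun_prop) (by fun_prop),
    h₁.map_prod_eq_prod_map_map (by fun_prop) (by fun_prop),
    h₂.map_prod_eq_prod_map_map (by fun_prop) (by fun_prop)]
  have := (measurePreserving_prodProdProdComm (P.map X₁) (P.map X₂) (P.map Y₁) (P.map Y₂)).map_eq
  rw [← this, ← e, Measure.map_map (by fun_prop) (by fun_prop)]
  rfl

lemma ProbabilityTheory.IndepFun.prodMk_left_of_prodMk_right {X : Ω → α₁} {Y : Ω → β₁} {Z : Ω → β₂}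
    (mX : Measurable X) (mY : Measurable Y) (mZ : Measurable Z)
    (h : IndepFun X (fun ω => (Y ω, Z ω)) P) (hYZ : IndepFun Y Z P) :
    IndepFun (fun ω => (X ω, Y ω)) Z P := by
  -- Pairing X with a constant reduces the claim to the regrouping of two pairs.
  have h' : IndepFun (fun ω => (X ω, ())) (fun ω => (Y ω, Z ω)) P :=
    h.comp (φ := fun x => (x, ())) (ψ := id) (by fun_prop) measurable_id
  exact (h'.regroup mX measurable_const mY mZ (indepFun_const_right _ _) hYZ).comp
    (φ := id) (ψ := Prod.snd) measurable_id measurable_snd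

/-- In a sequence of independent random variables, one is independent of the later ones. -/
lemma ProbabilityTheory.iIndepFun.indepFun_tail {X : ℕ → Ω → α₁} (hX : iIndepFun X P)
    (mX : ∀ k, Measurable (X k)) (k : ℕ) :
    IndepFun (X k) (fun ω j => X (k + 1 + j) ω) P := by
  have h := indep_iSup_of_disjoint (fun i => (mX i).comap_le) hX
    (S := {k}) (T := Set.Ioi k) (by simp)
  rw [IndepFun_iff_Indep]
  refine indep_of_indep_of_le_left (indep_of_indep_of_le_right h ?_) ?_
  · rw [← measurable_iff_comap_le]
    refine @measurable_pi_lambda _ _ _ (_) _ _ fun j => ?_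
    rw [measurable_iff_comap_le]
    exact le_iSup₂_of_le (k + 1 + j) (by simp; omega) le_rfl
  · exact le_iSup₂_of_le k (by simp) le_rfl

end Independence

/-! ### The queue lengths as a Markov chain driven by i.i.d. inputs -/

namespace GeneralizedSwitch.MaxWeightSystem

variable {n : ℕ} {𝒯 : Type*} [Fintype 𝒯] [MeasurableSpace 𝒯] [DiscreteMeasurableSpace 𝒯]
  {G : GeneralizedSwitch n 𝒯} {Ω : Type*} [MeasurableSpace Ω] {P : Measure Ω}
  [IsProbabilityMeasure P] (X : G.MaxWeightSystem P)

/-- The random input of the switch in slot `k`. -/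
def noise (k : ℕ) (ω : Ω) : (Fin n → ℕ) × 𝒯 × ℝ := (X.arrival k ω, X.channel k ω, X.seed k ω)

/-- The schedule selected with queue lengths `q` and input `x`. -/
def schedule (q : Fin n → ℕ) (x : (Fin n → ℕ) × 𝒯 × ℝ) : Fin n → ℕ := X.select q x.2.1 x.2.2

/-- The queue lengths in the next slot. -/
def step (q : Fin n → ℕ) (x : (Fin n → ℕ) × 𝒯 × ℝ) : Fin n → ℕ :=
  fun i => q i + x.1 i - X.schedule q x i

/-- The law of the random input in one slot. -/
noncomputable def noiseLaw : Measure ((Fin n → ℕ) × 𝒯 × ℝ) :=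
  (P.map (X.arrival 0)).prod (G.ψ.toMeasure.prod (P.map (X.seed 0)))

instance : IsProbabilityMeasure (P.map (X.arrival 0)) :=
  Measure.isProbabilityMeasure_map (X.measurable_arrival 0).aemeasurable

instance : IsProbabilityMeasure (P.map (X.seed 0)) :=
  Measure.isProbabilityMeasure_map (X.measurable_seed 0).aemeasurable

instance : IsProbabilityMeasure X.noiseLaw := by unfold noiseLaw; infer_instance

lemma measurable_noise (k : ℕ) : Measurable (X.noise k) :=
  (X.measurable_arrival k).prodMk ((X.measurable_channel k).prodMk (X.measurable_seed k))

lemma measurable_schedule :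
    Measurable (fun p : (Fin n → ℕ) × (Fin n → ℕ) × 𝒯 × ℝ => X.schedule p.1 p.2) := by
  refine measurable_from_prod_countable_right fun q => ?_
  have : Measurable (fun p : 𝒯 × ℝ => X.select q p.1 p.2) :=
    measurable_from_prod_countable_right fun t => X.measurable_select q t
  exact this.comp measurable_snd

lemma measurable_step :
    Measurable (fun p : (Fin n → ℕ) × (Fin n → ℕ) × 𝒯 × ℝ => X.step p.1 p.2) := by
  have h : Measurable (fun p : (Fin n → ℕ) × (Fin n → ℕ) × (Fin n → ℕ) =>
      (fun i => p.1 i + p.2.1 i - p.2.2 i : Fin n → ℕ)) := measurable_of_countable _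
  exact h.comp (measurable_fst.prodMk
    ((measurable_fst.comp measurable_snd).prodMk X.measurable_schedule))

lemma queue_succ_eq (k : ℕ) (ω : Ω) : X.queue (k + 1) ω = X.step (X.queue k ω) (X.noise k ω) :=
  funext fun i => X.queue_succ k ω i

lemma measurable_queue : ∀ k, Measurable (X.queue k)
  | 0 => X.measurable_queue_zero
  | k + 1 => by
    have := X.measurable_step.comp ((measurable_queue k).prodMk (X.measurable_noise k))
    convert this using 1
    exact funext fun ω => X.queue_succ_eq k ω

lemma map_noise (k : ℕ) : P.map (X.noise k) = X.noiseLaw := by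
  have mA := X.measurable_arrival k
  have mC := X.measurable_channel k
  have mS := X.measurable_seed k
  have h1 : IndepFun (X.arrival k) (fun ω => (X.channel k ω, X.seed k ω)) P :=
    X.arrival_indep_rest.comp (φ := fun f : ℕ → Fin n → ℕ => f k)
      (ψ := fun p : (ℕ → 𝒯) × (ℕ → ℝ) × (Fin n → ℕ) => (p.1 k, p.2.1 k))
      (by fun_prop) (by fun_prop)
  have h2 : IndepFun (X.channel k) (X.seed k) P :=
    X.channel_indep_rest.comp (φ := fun f : ℕ → 𝒯 => f k)
      (ψ := fun p : (ℕ → ℝ) × (Fin n → ℕ) => p.1 k)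
      (by fun_prop) (by fun_prop)
  unfold noise noiseLaw
  rw [h1.map_prod_eq_prod_map_map (by fun_prop) (by fun_prop),
    h2.map_prod_eq_prod_map_map (by fun_prop) (by fun_prop),
    (X.arrival_identDistrib k).map_eq, (X.seed_identDistrib k).map_eq, (X.channel_law k).map_eq]

lemma measurable_tail (k : ℕ) : Measurable (fun ω j => X.noise (k + j) ω) :=
  measurable_pi_lambda _ fun j => X.measurable_noise (k + j)

/-- Each of the three sources has its present independent of its future, and the sources are
independent of one another; regrouping source by source collects all presents and all futures. -/
lemma noise_indep_tail (k : ℕ) : IndepFun (X.noise k) (fun ω j => X.noise (k + 1 + j) ω) P := by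
  have mA := X.measurable_arrival
  have mC := X.measurable_channel
  have mS := X.measurable_seed
  have hA := X.arrival_indep.indepFun_tail mA k
  have hC := X.channel_indep.indepFun_tail mC k
  have hS := X.seed_indep.indepFun_tail mS k
  have h2 : IndepFun (fun ω => (X.channel k ω, fun j => X.channel (k + 1 + j) ω))
      (fun ω => (X.seed k ω, fun j => X.seed (k + 1 + j) ω)) P :=
    X.channel_indep_rest.comp (φ := fun f => (f k, fun j => f (k + 1 + j)))
      (ψ := fun p => (p.1 k, fun j => p.1 (k + 1 + j))) (by fun_prop) (by fun_prop)
  have h3 := h2.regroup (by fun_prop) (by fun_prop) (by fun_prop) (by fun_prop) hC hS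
  have h4 : IndepFun (fun ω => (X.arrival k ω, fun j => X.arrival (k + 1 + j) ω))
      (fun ω => ((X.channel k ω, X.seed k ω),
        ((fun j => X.channel (k + 1 + j) ω), (fun j => X.seed (k + 1 + j) ω)))) P :=
    X.arrival_indep_rest.comp (φ := fun f => (f k, fun j => f (k + 1 + j)))
      (ψ := fun p => ((p.1 k, p.2.1 k), ((fun j => p.1 (k + 1 + j)), fun j => p.2.1 (k + 1 + j))))
      (by fun_prop) (by fun_prop)
  have h5 := h4.regroup (by fun_prop) (by fun_prop) (by fun_prop) (by fun_prop) hA h3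
  exact h5.comp (φ := id) (ψ := fun p j => (p.1 j, p.2.1 j, p.2.2 j)) measurable_id (by fun_prop)

/-- The Markov property. By induction, the next queue vector is a function of the current one and
the current input, and this pair is independent of all later inputs. -/
lemma queue_indep_tail (k : ℕ) : IndepFun (X.queue k) (fun ω j => X.noise (k + j) ω) P := by
  induction k with
  | zero =>
    have mA := X.measurable_arrival
    have mC := X.measurable_channel
    have mS := X.measurable_seed
    have mQ := X.measurable_queue_zero
    have h1 := X.seed_indep_queue_zero.symm
    have h2 : IndepFun (X.queue 0)
        (fun ω => ((fun k => channel X k ω), (fun k => seed X k ω))) P := by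
      have := (X.channel_indep_rest.prodMk_left_of_prodMk_right (by fun_prop) (by fun_prop)
        (by fun_prop) X.seed_indep_queue_zero)
      exact this.symm
    have h3 : IndepFun (fun ω k => X.arrival k ω)
        (fun ω => (((fun k => X.channel k ω), (fun k => X.seed k ω)), X.queue 0 ω)) P :=
      X.arrival_indep_rest.comp (φ := id)
        (ψ := fun p : (ℕ → 𝒯) × (ℕ → ℝ) × (Fin n → ℕ) => ((p.1, p.2.1), p.2.2)) measurable_id (by fun_prop)
    have h4 := (h3.prodMk_left_of_prodMk_right (by fun_prop) (by fun_prop) (by fun_prop) h2.symm)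
    exact h4.symm.comp (φ := id) (ψ := fun p j => (p.1 (0 + j), p.2.1 (0 + j), p.2.2 (0 + j)))
      measurable_id (by fun_prop)
  | succ k ih =>
    have h1 : IndepFun (X.queue k)
        (fun ω => (X.noise k ω, fun j => X.noise (k + 1 + j) ω)) P := by
      have := ih.comp (φ := id) (ψ := fun f => (f 0, fun j => f (1 + j)))
        measurable_id (by fun_prop)
      simpa [Function.comp_def, add_assoc] using this
    have h2 := h1.prodMk_left_of_prodMk_right (X.measurable_queue k) (X.measurable_noise k)
      (X.measurable_tail (k + 1)) (X.noise_indep_tail k)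
    have h3 := h2.comp (φ := fun p => X.step p.1 p.2) (ψ := id) X.measurable_step measurable_id
    have e : X.queue (k + 1) = fun ω => X.step (X.queue k ω) (X.noise k ω) :=
      funext fun ω => X.queue_succ_eq k ω
    rw [e]
    exact h3

lemma map_queue_succ (k : ℕ) :
    P.map (X.queue (k + 1)) =
      ((P.map (X.queue k)).prod X.noiseLaw).map (fun p => X.step p.1 p.2) := by
  have h : IndepFun (X.queue k) (X.noise k) P :=
    (X.queue_indep_tail k).comp (φ := id) (ψ := fun f : ℕ → (Fin n → ℕ) × 𝒯 × ℝ => f 0) measurable_id (by fun_prop)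
  have e : X.queue (k + 1) = fun ω => X.step (X.queue k ω) (X.noise k ω) :=
    funext fun ω => X.queue_succ_eq k ω
  rw [← X.map_noise k, ← h.map_prod_eq_prod_map_map (X.measurable_queue k).aemeasurable
    (X.measurable_noise k).aemeasurable, Measure.map_map X.measurable_step
      ((X.measurable_queue k).prodMk (X.measurable_noise k)), e]
  rfl

/-- A limit in distribution of the queue lengths has a stationary law. -/
lemma stationary {Ω' : Type*} [MeasurableSpace Ω'] {P' : Measure Ω'} [IsProbabilityMeasure P']
    {qbar : Ω' → Fin n → ℕ}
    (h : TendstoInDistribution X.queue atTop qbar (fun _ => P) P') :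
    ((P'.map qbar).prod X.noiseLaw).map (fun p => X.step p.1 p.2) = P'.map qbar := by
  have hq := h.aemeasurable_limit
  have : IsProbabilityMeasure (P'.map qbar) := Measure.isProbabilityMeasure_map hq
  have : ∀ k, IsProbabilityMeasure (P.map (X.queue k)) := fun k =>
    Measure.isProbabilityMeasure_map (X.measurable_queue k).aemeasurable
  have : IsProbabilityMeasure
      (((P'.map qbar).prod X.noiseLaw).map (fun p => X.step p.1 p.2)) :=
    Measure.isProbabilityMeasure_map X.measurable_step.aemeasurable
  have key := ProbabilityMeasure.tendsto_iff_forall_integral_tendsto.1 h.tendsto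
  refine ext_of_forall_integral_eq_of_IsFiniteMeasure fun f => ?_
  have h1 := (tendsto_add_atTop_iff_nat 1).2 (key f)
  refine tendsto_nhds_unique ?_ h1
  have hint : ∀ μ : Measure (Fin n → ℕ), IsProbabilityMeasure μ →
      ∫ q, f q ∂((μ.prod X.noiseLaw).map (fun p => X.step p.1 p.2)) =
        ∫ q, (∫ x, f (X.step q x) ∂X.noiseLaw) ∂μ := by
    intro μ _
    rw [integral_map X.measurable_step.aemeasurable
      (measurable_of_countable f).aestronglyMeasurable]
    refine integral_prod (fun p => f (X.step p.1 p.2)) ?_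
    exact Integrable.of_bound
      ((measurable_of_countable f).comp X.measurable_step).aestronglyMeasurable ‖f‖
      (Eventually.of_forall fun p => f.norm_coe_le_norm _)
  -- The transition operator maps `f` to a bounded function, which is continuous because the state
  -- space is discrete. Testing the convergence with `g` and, one slot later, with `f` gives two
  -- limits of the same sequence.
  let g : BoundedContinuousFunction (Fin n → ℕ) ℝ :=
    BoundedContinuousFunction.ofNormedAddCommGroup (fun q => ∫ x, f (X.step q x) ∂X.noiseLaw)
      continuous_of_discreteTopology ‖f‖ (fun q => by
        have := norm_integral_le_of_norm_le_const (μ := X.noiseLaw) (f := fun x => f (X.step q x))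
          (C := ‖f‖) (Eventually.of_forall fun p => f.norm_coe_le_norm _)
        simpa using this)
  have h2 := key g
  rw [hint _ inferInstance]
  refine h2.congr fun k => ?_
  change ∫ q, (∫ x, f (X.step q x) ∂X.noiseLaw) ∂(P.map (X.queue k)) =
    ∫ q, f q ∂(P.map (X.queue (k + 1)))
  rw [X.map_queue_succ k, hint _ inferInstance]

end GeneralizedSwitch.MaxWeightSystem

/-! ### A moment bound for stationary laws -/

/-- Foster's criterion: a stationary law integrates the negative part of the drift of a nonnegative
function. -/
lemma lintegral_le_of_drift {Q N : Type*} [MeasurableSpace Q] [MeasurableSpace N]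
    {π : Measure Q} {ν : Measure N} [IsProbabilityMeasure π] [IsProbabilityMeasure ν]
    {Φ : Q → N → Q} (mΦ : Measurable (fun p : Q × N => Φ p.1 p.2))
    (hstat : (π.prod ν).map (fun p => Φ p.1 p.2) = π) {V f : Q → ℝ} (mV : Measurable V)
    (mf : Measurable f) (hV : ∀ q, 0 ≤ V q) (hf : ∀ q, 0 ≤ f q) {K : ℝ} (hK : 0 ≤ K)
    (hint : ∀ q, Integrable (fun x => V (Φ q x)) ν)
    (hdrift : ∀ q, ∫ x, V (Φ q x) ∂ν ≤ V q - f q + K) :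
    ∫⁻ q, ENNReal.ofReal (f q) ∂π ≤ ENNReal.ofReal K := by
  -- `V` need not be integrable under `π`, so both `V` and its drift bound are truncated at `R`.
  -- Stationarity makes the integral of `h R` at most `K`; as `h R` is nonnegative and eventually
  -- equal to `f`, Fatou's lemma applies.
  set g : ℕ → Q → ℝ := fun R q => min (V q - f q + K) R with hg
  set h : ℕ → Q → ℝ := fun R q => K - (g R q - min (V q) R) with hh
  have nonneg (q : Q) : 0 ≤ V q - f q + K :=
    (integral_nonneg fun x => hV (Φ q x)).trans (hdrift q)
  have g0 (R : ℕ) (q : Q) : 0 ≤ g R q := le_min (nonneg q) R.cast_nonneg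
  have m0 (R : ℕ) (q : Q) : 0 ≤ min (V q) R := le_min (hV q) R.cast_nonneg
  have mg (R : ℕ) : Measurable (g R) := by fun_prop
  have mh (R : ℕ) : Measurable (h R) := by fun_prop
  have h0 (R : ℕ) (q : Q) : 0 ≤ h R q := by
    have : g R q ≤ min (V q) R + K := by
      rw [← min_add_add_right]
      exact min_le_min (by linarith [hf q]) (by linarith)
    simp only [hh]; linarith
  have ig (R : ℕ) : Integrable (g R) π :=
    Integrable.of_bound (mg R).aestronglyMeasurable R (Eventually.of_forall fun q => by
      rw [Real.norm_of_nonneg (g0 R q)]; exact min_le_right _ _)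
  have iV (R : ℕ) : Integrable (fun q => min (V q) (R : ℝ)) π :=
    Integrable.of_bound (by fun_prop) R (Eventually.of_forall fun q => by
      rw [Real.norm_of_nonneg (m0 R q)]; exact min_le_right _ _)
  have iVΦ (R : ℕ) : Integrable (fun p : Q × N => min (V (Φ p.1 p.2)) (R : ℝ)) (π.prod ν) :=
    Integrable.of_bound ((mV.comp mΦ).min measurable_const).aestronglyMeasurable R
      (Eventually.of_forall fun p => by
        rw [Real.norm_of_nonneg (m0 R _)]; exact min_le_right _ _)
  have iVq (R : ℕ) (q : Q) : Integrable (fun x => min (V (Φ q x)) (R : ℝ)) ν :=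
    Integrable.of_bound ((mV.comp (mΦ.comp measurable_prodMk_left)).min
      measurable_const).aestronglyMeasurable R (Eventually.of_forall fun p => by
        rw [Real.norm_of_nonneg (m0 R _)]; exact min_le_right _ _)
  have key (R : ℕ) : ∫⁻ q, ENNReal.ofReal (h R q) ∂π ≤ ENNReal.ofReal K := by
    have ih : Integrable (h R) π := (integrable_const K).sub ((ig R).sub (iV R))
    rw [← ofReal_integral_eq_lintegral_ofReal ih (Eventually.of_forall (h0 R))]
    refine ENNReal.ofReal_le_ofReal ?_
    have e : ∫ q, min (V q) (R : ℝ) ∂π ≤ ∫ q, g R q ∂π := by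
      have : ∫ q, min (V q) (R : ℝ) ∂π = ∫ q, ∫ x, min (V (Φ q x)) (R : ℝ) ∂ν ∂π := by
        rw [← integral_prod _ (iVΦ R)]
        conv_lhs => rw [← hstat]
        rw [integral_map mΦ.aemeasurable (by fun_prop)]
      rw [this]
      refine integral_mono (iVΦ R).integral_prod_left (ig R) fun q => le_min ?_ ?_
      · exact (integral_mono (iVq R q) (hint q) fun x => min_le_left _ _).trans (hdrift q)
      · refine (integral_mono (iVq R q) (integrable_const (R : ℝ)) fun x => min_le_right _ _).trans ?_
        simp
    have e1 : ∫ q, h R q ∂π = K - (∫ q, g R q ∂π - ∫ q, min (V q) (R : ℝ) ∂π) := by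
      rw [← integral_sub (ig R) (iV R)]
      exact (integral_sub (integrable_const K) ((ig R).sub (iV R))).trans (by simp)
    rw [e1]
    linarith
  have lim (q : Q) :
      liminf (fun R : ℕ => ENNReal.ofReal (h R q)) atTop = ENNReal.ofReal (f q) := by
    refine Tendsto.liminf_eq (tendsto_const_nhds.congr' ?_)
    filter_upwards [(tendsto_natCast_atTop_atTop (R := ℝ)).eventually_ge_atTop (V q),
      (tendsto_natCast_atTop_atTop (R := ℝ)).eventually_ge_atTop (V q - f q + K)] with R h1 h2
    simp only [hh, hg, min_eq_left h1, min_eq_left h2]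
    congr 1; ring
  calc ∫⁻ q, ENNReal.ofReal (f q) ∂π
      = ∫⁻ q, liminf (fun R : ℕ => ENNReal.ofReal (h R q)) atTop ∂π := by simp_rw [lim]
    _ ≤ liminf (fun R : ℕ => ∫⁻ q, ENNReal.ofReal (h R q) ∂π) atTop :=
        lintegral_liminf_le fun R => (mh R).ennreal_ofReal
    _ ≤ liminf (fun _ : ℕ => ENNReal.ofReal K) atTop :=
        liminf_le_liminf (Eventually.of_forall key)
    _ = ENNReal.ofReal K := by simp

/-! ### Geometry of the capacity region -/

section Geometry

variable {n : ℕ}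

lemma inner_natVec (v : EuclideanSpace ℝ (Fin n)) (x : Fin n → ℕ) :
    ⟪v, natVec x⟫ = ∑ i, v i * x i := by
  simp [natVec, PiLp.inner_apply, mul_comm]

/-- The component of `v` orthogonal to the unit vector `c`. -/
noncomputable def perp (c v : EuclideanSpace ℝ (Fin n)) : EuclideanSpace ℝ (Fin n) :=
  v - ⟪c, v⟫ • c

lemma inner_perp {c : EuclideanSpace ℝ (Fin n)} (hc : ‖c‖ = 1) (v : EuclideanSpace ℝ (Fin n)) :
    ⟪c, perp c v⟫ = 0 := by
  rw [perp, inner_sub_right, inner_smul_right, real_inner_self_eq_norm_sq, hc]; ring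

lemma perp_inner (c v x : EuclideanSpace ℝ (Fin n)) :
    ⟪perp c v, x⟫ = ⟪v, x⟫ - ⟪c, v⟫ * ⟪c, x⟫ := by
  rw [perp, inner_sub_left, real_inner_smul_left]

lemma norm_perp_sq {c : EuclideanSpace ℝ (Fin n)} (hc : ‖c‖ = 1) (v : EuclideanSpace ℝ (Fin n)) :
    ‖perp c v‖ ^ 2 = ‖v‖ ^ 2 - ⟪c, v⟫ ^ 2 := by
  rw [← real_inner_self_eq_norm_sq, perp_inner, inner_perp hc, ← real_inner_self_eq_norm_sq v]
  rw [real_inner_comm, perp_inner]; ring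

lemma norm_perp_le {c : EuclideanSpace ℝ (Fin n)} (hc : ‖c‖ = 1) (v : EuclideanSpace ℝ (Fin n)) :
    ‖perp c v‖ ≤ ‖v‖ := by
  refine abs_le_of_sq_le_sq' ?_ (norm_nonneg v) |>.2
  rw [norm_perp_sq hc]; nlinarith [sq_nonneg ⟪c, v⟫]

lemma perp_sub (c v w : EuclideanSpace ℝ (Fin n)) : perp c (v - w) = perp c v - perp c w := by
  simp only [perp, inner_sub_right, sub_smul]; abel

namespace GeneralizedSwitch

variable {𝒯 : Type*} (G : GeneralizedSwitch n 𝒯)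

lemma inner_le_maxRate (v : EuclideanSpace ℝ (Fin n)) {t : 𝒯} {s : Fin n → ℕ} (hs : s ∈ G.S t) :
    ⟪v, natVec s⟫ ≤ G.maxRate v t :=
  Finset.le_sup' (fun s => ⟪v, natVec s⟫) hs

lemma exists_inner_eq_maxRate (v : EuclideanSpace ℝ (Fin n)) (t : 𝒯) :
    ∃ s ∈ G.S t, ⟪v, natVec s⟫ = G.maxRate v t := by
  obtain ⟨s, hs, h⟩ := Finset.exists_mem_eq_sup' (G.S_nonempty t) (fun s => ⟪v, natVec s⟫)
  exact ⟨s, hs, h.symm⟩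

lemma inner_eq_maxRate_of_mem_maxWeightSet {q s : Fin n → ℕ} {t : 𝒯} (hs : s ∈ G.maxWeightSet q t) :
    ⟪natVec q, natVec s⟫ = G.maxRate (natVec q) t := by
  have key (x : Fin n → ℕ) : ⟪natVec q, natVec x⟫ = ((∑ i, x i * q i : ℕ) : ℝ) := by
    rw [inner_natVec]; push_cast
    exact Finset.sum_congr rfl fun i _ => by simp [natVec, mul_comm]
  refine le_antisymm (G.inner_le_maxRate _ hs.1) (Finset.sup'_le _ _ fun y hy => ?_)
  rw [key, key]
  exact_mod_cast hs.2 y hy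

variable [Fintype 𝒯]

/-- The support function of the capacity region. -/
noncomputable def meanMaxRate (v : EuclideanSpace ℝ (Fin n)) : ℝ :=
  ∑ t, (G.ψ t).toReal * G.maxRate v t

lemma inner_le_meanMaxRate (v : EuclideanSpace ℝ (Fin n)) {x : EuclideanSpace ℝ (Fin n)}
    (hx : x ∈ G.capacityRegion) : ⟪v, x⟫ ≤ G.meanMaxRate v := by
  rw [capacityRegion, Set.mem_finsetSum] at hx
  obtain ⟨g, hg, rfl⟩ := hx
  rw [inner_sum, meanMaxRate]
  refine Finset.sum_le_sum fun t _ => ?_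
  obtain ⟨y, hy, e⟩ := Set.mem_smul_set.1 (hg (Finset.mem_univ t))
  rw [← e, inner_smul_right]
  refine mul_le_mul_of_nonneg_left ?_ ENNReal.toReal_nonneg
  have hconv : Convex ℝ {y : EuclideanSpace ℝ (Fin n) | ⟪v, y⟫ ≤ G.maxRate v t} :=
    convex_halfSpace_le (innerₛₗ ℝ v).isLinear _
  refine convexHull_min ?_ hconv hy
  rintro _ ⟨s, hs, rfl⟩
  exact G.inner_le_maxRate v hs

lemma exists_inner_eq_meanMaxRate (v : EuclideanSpace ℝ (Fin n)) :
    ∃ x ∈ G.capacityRegion, ⟪v, x⟫ = G.meanMaxRate v := by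
  choose s hs e using G.exists_inner_eq_maxRate v
  refine ⟨∑ t, (G.ψ t).toReal • natVec (s t), ?_, ?_⟩
  · rw [capacityRegion, Set.mem_finsetSum]
    refine ⟨fun t => (G.ψ t).toReal • natVec (s t), fun {t} _ => ?_, rfl⟩
    exact Set.smul_mem_smul_set (subset_convexHull ℝ _ ⟨s t, hs t, rfl⟩)
  · rw [inner_sum, meanMaxRate]
    exact Finset.sum_congr rfl fun t _ => by rw [inner_smul_right, e]

lemma meanMaxRate_eq {c : EuclideanSpace ℝ (Fin n)} {b : ℝ}
    (hc : IsFacetInequality G.capacityRegion c b) {r : EuclideanSpace ℝ (Fin n)}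
    (hr : r ∈ faceOf G.capacityRegion c b) : G.meanMaxRate c = b := by
  refine le_antisymm ?_ ?_
  · obtain ⟨x, hx, e⟩ := G.exists_inner_eq_meanMaxRate c
    rw [← e]; exact hc.valid x hx
  · rw [← hr.2]; exact G.inner_le_meanMaxRate c hr.1

end GeneralizedSwitch

/-- Around a point of the relative interior of a facet, the region contains a ball of the
hyperplane of the facet. -/
lemma IsFacetInequality.exists_ball {C : Set (EuclideanSpace ℝ (Fin n))}
    {c : EuclideanSpace ℝ (Fin n)} {b : ℝ} (hc : IsFacetInequality C c b)
    {r : EuclideanSpace ℝ (Fin n)} (hr : r ∈ intrinsicInterior ℝ (faceOf C c b)) :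
    ∃ δ > 0, ∀ v, ⟪c, v⟫ = 0 → ‖v‖ ≤ δ → r + v ∈ C := by
  have hrF : r ∈ faceOf C c b := intrinsicInterior_subset hr
  have hc0 : c ≠ 0 := by
    rintro rfl; simpa using hc.norm_eq_one
  have hle : vectorSpan ℝ (faceOf C c b) ≤ (ℝ ∙ c)ᗮ := by
    rw [vectorSpan_def, Submodule.span_le]
    rintro _ ⟨x, hx, y, hy, rfl⟩
    rw [SetLike.mem_coe, Submodule.mem_orthogonal_singleton_iff_inner_right]
    simp only [vsub_eq_sub]
    rw [inner_sub_right, hx.2, hy.2, sub_self]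
  -- A facet has codimension one, so its directions fill the whole hyperplane orthogonal to `c`.
  have heq : vectorSpan ℝ (faceOf C c b) = (ℝ ∙ c)ᗮ := by
    refine Submodule.eq_of_le_of_finrank_eq hle ?_
    have h1 := Submodule.finrank_add_finrank_orthogonal (ℝ ∙ c)
    rw [finrank_span_singleton hc0, finrank_euclideanSpace, Fintype.card_fin] at h1
    have h2 := hc.codim_one
    omega
  obtain ⟨y, hy, rfl⟩ := mem_intrinsicInterior.1 hr
  obtain ⟨δ, hδ, hball⟩ := Metric.isOpen_iff.1 isOpen_interior y hy
  refine ⟨δ / 2, by positivity, fun v hv hvδ => ?_⟩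
  have hvs : v ∈ (affineSpan ℝ (faceOf C c b)).direction := by
    rw [direction_affineSpan, heq, Submodule.mem_orthogonal_singleton_iff_inner_right]; exact hv
  have hmem : (y : EuclideanSpace ℝ (Fin n)) + v ∈ affineSpan ℝ (faceOf C c b) := by
    rw [add_comm]; exact AffineSubspace.vadd_mem_of_mem_direction hvs y.2
  have : (⟨y + v, hmem⟩ : affineSpan ℝ (faceOf C c b)) ∈ Metric.ball y δ := by
    rw [Metric.mem_ball, Subtype.dist_eq]
    simp only [dist_eq_norm, add_sub_cancel_left]
    linarith
  exact (interior_subset (hball this)).1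

/-- Moving from `r` by length `δ` in the direction of `perp c v` stays in the region, and the
support function at `v` is at least the value there. This is the source of the negative drift
orthogonal to `c`. -/
lemma GeneralizedSwitch.exists_inner_add_le_meanMaxRate {𝒯 : Type*} [Fintype 𝒯]
    (G : GeneralizedSwitch n 𝒯) {c : EuclideanSpace ℝ (Fin n)} {b : ℝ}
    (hc : IsFacetInequality G.capacityRegion c b) {r : EuclideanSpace ℝ (Fin n)}
    (hr : r ∈ intrinsicInterior ℝ (faceOf G.capacityRegion c b)) :
    ∃ δ > 0, ∀ v, ⟪v, r⟫ + δ * ‖perp c v‖ ≤ G.meanMaxRate v := by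
  obtain ⟨δ, hδ, h⟩ := hc.exists_ball hr
  refine ⟨δ, hδ, fun v => ?_⟩
  have hn := hc.norm_eq_one
  rcases eq_or_ne (perp c v) 0 with h0 | h0
  · rw [h0, norm_zero, mul_zero, add_zero]
    exact G.inner_le_meanMaxRate v (intrinsicInterior_subset hr).1
  · have hpos : 0 < ‖perp c v‖ := norm_pos_iff.2 h0
    have := G.inner_le_meanMaxRate v (h ((δ / ‖perp c v‖) • perp c v)
      (by rw [inner_smul_right, inner_perp hn, mul_zero])
      (by rw [norm_smul, Real.norm_of_nonneg (by positivity), div_mul_cancel₀ _ hpos.ne']))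
    rw [inner_add_right, inner_smul_right] at this
    have e : ⟪v, perp c v⟫ = ‖perp c v‖ ^ 2 := by
      rw [norm_perp_sq hn, real_inner_comm, perp_inner, real_inner_self_eq_norm_sq]; ring
    rw [e] at this
    have e2 : δ / ‖perp c v‖ * ‖perp c v‖ ^ 2 = δ * ‖perp c v‖ := by field_simp
    linarith

end Geometry

/-! ### One slot of the switch -/

section OneSlot

variable {n : ℕ}

lemma norm_le_norm_of_abs_le {x y : EuclideanSpace ℝ (Fin n)} (h : ∀ i, |x i| ≤ |y i|) :
    ‖x‖ ≤ ‖y‖ := by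
  rw [EuclideanSpace.norm_eq, EuclideanSpace.norm_eq]
  refine Real.sqrt_le_sqrt (Finset.sum_le_sum fun i _ => ?_)
  exact pow_le_pow_left₀ (norm_nonneg _) (h i) 2

lemma natVec_apply (x : Fin n → ℕ) (i : Fin n) : natVec x i = x i := rfl

lemma natVec_mono {x y : Fin n → ℕ} (h : ∀ i, x i ≤ y i) : ‖natVec x‖ ≤ ‖natVec y‖ :=
  norm_le_norm_of_abs_le fun i => by
    rw [natVec_apply, natVec_apply, Nat.abs_cast, Nat.abs_cast]; exact Nat.cast_le.2 (h i)

lemma inner_natVec_nonneg {c : EuclideanSpace ℝ (Fin n)} (hc : ∀ i, 0 ≤ c i) (x : Fin n → ℕ) :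
    0 ≤ ⟪c, natVec x⟫ := by
  rw [inner_natVec]
  exact Finset.sum_nonneg fun i _ => mul_nonneg (hc i) (Nat.cast_nonneg _)

/-- The unused service. -/
def unused (q a s : Fin n → ℕ) : Fin n → ℕ := fun i => s i - (q i + a i)

lemma natVec_next (q a s : Fin n → ℕ) :
    natVec (fun i => q i + a i - s i) =
      natVec q + (natVec a - natVec s) + natVec (unused q a s) := by
  ext i
  simp only [natVec_apply, PiLp.add_apply, PiLp.sub_apply, unused]
  rcases le_total (s i) (q i + a i) with h | h
  · rw [Nat.cast_sub h, Nat.sub_eq_zero_of_le h]; push_cast; ring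
  · rw [Nat.cast_sub h, Nat.sub_eq_zero_of_le h]; push_cast; ring

lemma norm_natVec_next_le (q a s : Fin n → ℕ) :
    ‖natVec (fun i => q i + a i - s i)‖ ≤ ‖natVec q + (natVec a - natVec s)‖ := by
  refine norm_le_norm_of_abs_le fun i => ?_
  simp only [natVec_apply, PiLp.add_apply, PiLp.sub_apply]
  rcases le_total (s i) (q i + a i) with h | h
  · rw [Nat.cast_sub h]; push_cast; exact le_of_eq (by congr 1; ring)
  · rw [Nat.sub_eq_zero_of_le h]; simp

lemma norm_unused_le (q a s : Fin n → ℕ) : ‖natVec (unused q a s)‖ ≤ ‖natVec s‖ :=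
  natVec_mono fun _ => Nat.sub_le _ _

/-- By Pythagoras the left side is a squared norm minus a squared `c`-component. Truncation at zero
only lowers the norm, while unused service only raises the `c`-component; the discarded terms are a
square and a product of nonnegative numbers. -/
lemma norm_perp_next_sq_le {c : EuclideanSpace ℝ (Fin n)} (hc : ‖c‖ = 1) (hc0 : ∀ i, 0 ≤ c i)
    (q a s : Fin n → ℕ) :
    ‖perp c (natVec (fun i => q i + a i - s i))‖ ^ 2 ≤ ‖perp c (natVec q)‖ ^ 2 +
      ‖natVec a - natVec s‖ ^ 2 + 2 * (⟪natVec q, natVec a - natVec s⟫ -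
        ⟪c, natVec q⟫ * ⟪c, natVec a - natVec s⟫) := by
  have h1 := pow_le_pow_left₀ (norm_nonneg _) (norm_natVec_next_le q a s) 2
  rw [norm_add_sq_real] at h1
  have h2 : ⟪c, natVec (fun i => q i + a i - s i)⟫ =
      ⟪c, natVec q⟫ + ⟪c, natVec a - natVec s⟫ + ⟪c, natVec (unused q a s)⟫ := by
    rw [natVec_next, inner_add_right, inner_add_right]
  have h3 := inner_natVec_nonneg hc0 q
  have h4 := inner_natVec_nonneg hc0 (unused q a s)
  rw [norm_perp_sq hc, norm_perp_sq hc, h2]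
  nlinarith [sq_nonneg (⟪c, natVec a - natVec s⟫ + ⟪c, natVec (unused q a s)⟫),
    mul_nonneg h3 h4]

/-- Service is unused only if the queue length vector is far from the ray of `c`. -/
lemma inner_next_mul_unused_le {c : EuclideanSpace ℝ (Fin n)} (hc0 : ∀ i, 0 ≤ c i) {K : ℝ}
    (hK : ∀ i, (c i)⁻¹ ≤ K) (q a s : Fin n → ℕ) :
    ⟪c, natVec (fun i => q i + a i - s i)⟫ * ⟪c, natVec (unused q a s)⟫ ≤
      K * ‖perp c (natVec (fun i => q i + a i - s i))‖ * ⟪c, natVec (unused q a s)⟫ := by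
  set z := natVec (fun i => q i + a i - s i) with hz
  rw [inner_natVec c (unused q a s), Finset.mul_sum, Finset.mul_sum]
  refine Finset.sum_le_sum fun i _ => ?_
  rcases (hc0 i).eq_or_lt with h0 | h0
  · simp [← h0]
  rcases Nat.eq_zero_or_pos (unused q a s i) with hu | hu
  · simp [hu]
  -- A queue with unused service is empty in the next slot, so the `i`-th coordinate of `perp c z`
  -- is `-⟪c, z⟫ * c i`, which bounds `⟪c, z⟫` by the distance from the line.
  have hzi : z i = 0 := by
    rw [hz, natVec_apply]
    have : q i + a i - s i = 0 := by unfold unused at hu; omega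
    simp [this]
  refine mul_le_mul_of_nonneg_right ?_ (by positivity)
  have h1 : |perp c z i| ≤ ‖perp c z‖ := by
    simpa using PiLp.norm_apply_le (perp c z) i
  have h2 : perp c z i = -(⟪c, z⟫ * c i) := by
    simp only [perp, PiLp.sub_apply, PiLp.smul_apply, smul_eq_mul, hzi]; ring
  rw [h2, abs_neg] at h1
  have h3 : ⟪c, z⟫ * c i ≤ ‖perp c z‖ := (le_abs_self _).trans h1
  calc ⟪c, z⟫ = (⟪c, z⟫ * c i) * (c i)⁻¹ := by field_simp
    _ ≤ ‖perp c z‖ * (c i)⁻¹ := by gcongr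
    _ ≤ ‖perp c z‖ * K := by gcongr; exact hK i
    _ = K * ‖perp c z‖ := mul_comm _ _

namespace GeneralizedSwitch

variable {𝒯 : Type*} (G : GeneralizedSwitch n 𝒯)

/-- Besides bounding the schedules, this bounds the inverse of the gap between the best and the
second best `c`-weight; a zero gap has inverse zero and does no harm. -/
lemma exists_forall_le [Finite 𝒯] (f : 𝒯 → (Fin n → ℕ) → ℝ) :
    ∃ M, ∀ t, ∀ s ∈ G.S t, f t s ≤ M := by
  have h (t : 𝒯) : ∃ M, ∀ s ∈ G.S t, f t s ≤ M := by
    obtain ⟨M, hM⟩ := Finset.exists_le ((G.S t).image (f t))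
    exact ⟨M, fun s hs => hM _ (Finset.mem_image_of_mem _ hs)⟩
  choose M hM using h
  obtain ⟨M', hM'⟩ := (Set.finite_range M).bddAbove
  exact ⟨M', fun t s hs => (hM t s hs).trans (hM' ⟨t, rfl⟩)⟩

/-- MaxWeight selects a schedule of less than maximal `c`-weight only if the queue length vector
is far from the ray of `c`. -/
lemma inner_mul_maxRate_sub_le {c : EuclideanSpace ℝ (Fin n)} {B K : ℝ}
    (hB : ∀ t, ∀ s ∈ G.S t, ‖natVec s‖ ≤ B)
    (hK : ∀ t, ∀ s ∈ G.S t, (G.maxRate c t - ⟪c, natVec s⟫)⁻¹ ≤ K) {q s : Fin n → ℕ} {t : 𝒯}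
    (hs : s ∈ G.maxWeightSet q t) :
    ⟪c, natVec q⟫ * (G.maxRate c t - ⟪c, natVec s⟫) ≤
      2 * B * K * ‖perp c (natVec q)‖ * (G.maxRate c t - ⟪c, natVec s⟫) := by
  set d := G.maxRate c t - ⟪c, natVec s⟫ with hd
  have hd0 : 0 ≤ d := sub_nonneg.2 (G.inner_le_maxRate c hs.1)
  rcases hd0.eq_or_lt with h0 | h0
  · simp [← h0]
  obtain ⟨s', hs', e⟩ := G.exists_inner_eq_maxRate c t
  have h1 : ⟪natVec q, natVec s'⟫ ≤ ⟪natVec q, natVec s⟫ := by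
    rw [G.inner_eq_maxRate_of_mem_maxWeightSet hs]; exact G.inner_le_maxRate _ hs'
  -- MaxWeight prefers `s` to the `c`-optimal `s'`, so the gain of `s` over `s'` orthogonal to `c`
  -- must pay for the loss `⟪c, natVec q⟫ * d` along `c`.
  have h2 := perp_inner c (natVec q) (natVec s - natVec s')
  rw [inner_sub_right (natVec q), inner_sub_right c, e] at h2
  have h3 := real_inner_le_norm (perp c (natVec q)) (natVec s - natVec s')
  have h4 : ‖natVec s - natVec s'‖ ≤ 2 * B := by
    have := norm_sub_le (natVec s) (natVec s')
    linarith [hB t s hs.1, hB t s' hs']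
  have hB0 : 0 ≤ B := (norm_nonneg _).trans (hB t s hs.1)
  have h5 : ⟪c, natVec q⟫ * d ≤ 2 * B * ‖perp c (natVec q)‖ := by
    have := mul_le_mul_of_nonneg_left h4 (norm_nonneg (perp c (natVec q)))
    nlinarith
  -- A positive loss is bounded below. This reintroduces the factor `d`, whose stationary mean is at
  -- most ε in the application.
  have h6 : 1 ≤ K * d := by
    have := mul_le_mul_of_nonneg_right (hK t s hs.1) hd0
    rwa [← hd, inv_mul_cancel₀ h0.ne'] at this
  calc ⟪c, natVec q⟫ * d ≤ 2 * B * ‖perp c (natVec q)‖ * 1 := by simpa using h5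
    _ ≤ 2 * B * ‖perp c (natVec q)‖ * (K * d) := by gcongr
    _ = _ := by ring

end GeneralizedSwitch

end OneSlot

/-! ### State space collapse -/

namespace GeneralizedSwitch.MaxWeightSystem

variable {n : ℕ} {𝒯 : Type*} [Fintype 𝒯] [MeasurableSpace 𝒯] [DiscreteMeasurableSpace 𝒯]
  {G : GeneralizedSwitch n 𝒯} {Ω : Type*} [MeasurableSpace Ω] {P : Measure Ω}
  [IsProbabilityMeasure P] (X : G.MaxWeightSystem P)

lemma measurePreserving_noise_arrival :
    MeasurePreserving Prod.fst X.noiseLaw (P.map (X.arrival 0)) :=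
  measurePreserving_fst

lemma measurePreserving_noise_channel :
    MeasurePreserving (fun x : (Fin n → ℕ) × 𝒯 × ℝ => x.2.1) X.noiseLaw G.ψ.toMeasure :=
  measurePreserving_fst.comp measurePreserving_snd

lemma ae_noise_arrival_le {A : ℕ} (hA : ∀ᵐ ω ∂P, ∀ i, X.arrival 0 ω i ≤ A) :
    ∀ᵐ x ∂X.noiseLaw, ∀ i, x.1 i ≤ A := by
  have h : ∀ᵐ a ∂(P.map (X.arrival 0)), ∀ i, a i ≤ A :=
    (ae_map_iff (X.measurable_arrival 0).aemeasurable
      (MeasurableSet.of_discrete (s := {a : Fin n → ℕ | ∀ i, a i ≤ A}))).2 hA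
  exact X.measurePreserving_noise_arrival.quasiMeasurePreserving.ae h

lemma integral_noise_arrival (f : (Fin n → ℕ) → ℝ) :
    ∫ x, f x.1 ∂X.noiseLaw = ∫ ω, f (X.arrival 0 ω) ∂P := by
  have mf : Measurable f := measurable_of_countable f
  rw [← integral_map (X.measurable_arrival 0).aemeasurable mf.aestronglyMeasurable,
    ← X.measurePreserving_noise_arrival.map_eq,
    integral_map measurable_fst.aemeasurable mf.aestronglyMeasurable]

lemma integral_noise_channel (f : 𝒯 → ℝ) :
    ∫ x, f x.2.1 ∂X.noiseLaw = ∫ t, f t ∂G.ψ.toMeasure := by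
  have mf : Measurable f := Measurable.of_discrete
  rw [← X.measurePreserving_noise_channel.map_eq,
    integral_map X.measurePreserving_noise_channel.aemeasurable mf.aestronglyMeasurable]

lemma integral_maxRate (v : EuclideanSpace ℝ (Fin n)) :
    ∫ x, G.maxRate v x.2.1 ∂X.noiseLaw = G.meanMaxRate v := by
  rw [X.integral_noise_channel, PMF.integral_eq_sum]
  rfl

lemma integrable_noise_channel (f : 𝒯 → ℝ) : Integrable (fun x => f x.2.1) X.noiseLaw := by
  have mf : Measurable f := Measurable.of_discrete
  obtain ⟨M, hM⟩ := (Set.finite_range fun t => ‖f t‖).bddAbove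
  exact Integrable.of_bound (mf.comp (by fun_prop)).aestronglyMeasurable M
    (Eventually.of_forall fun x => hM ⟨_, rfl⟩)

lemma norm_natVec_le {A : ℕ} {a : Fin n → ℕ} (ha : ∀ i, a i ≤ A) :
    ‖natVec a‖ ≤ ‖natVec (fun _ : Fin n => A)‖ := natVec_mono ha

lemma integrable_noise_arrival {A : ℕ} (hA : ∀ᵐ ω ∂P, ∀ i, X.arrival 0 ω i ≤ A)
    (f : (Fin n → ℕ) → ℝ) : Integrable (fun x => f x.1) X.noiseLaw := by
  have mf : Measurable f := measurable_of_countable f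
  obtain ⟨M, hM⟩ := ((Set.finite_Iic (fun _ : Fin n => A)).image fun a => ‖f a‖).bddAbove
  refine Integrable.of_bound (mf.comp (by fun_prop)).aestronglyMeasurable M ?_
  filter_upwards [X.ae_noise_arrival_le hA] with x hx
  exact hM ⟨x.1, hx, rfl⟩

lemma integral_inner_arrival {A : ℕ} (hA : ∀ᵐ ω ∂P, ∀ i, X.arrival 0 ω i ≤ A)
    {l : EuclideanSpace ℝ (Fin n)} (hl : ∀ i, ∫ ω, (X.arrival 0 ω i : ℝ) ∂P = l i)
    (v : EuclideanSpace ℝ (Fin n)) : ∫ x, ⟪v, natVec x.1⟫ ∂X.noiseLaw = ⟪v, l⟫ := by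
  simp_rw [inner_natVec]
  rw [integral_finsetSum _ fun i _ =>
    (X.integrable_noise_arrival hA (fun a => (a i : ℝ))).const_mul (v i)]
  simp_rw [integral_const_mul]
  simp only [PiLp.inner_apply, RCLike.inner_apply, conj_trivial]
  refine Finset.sum_congr rfl fun i _ => ?_
  rw [X.integral_noise_arrival (fun a => (a i : ℝ)), hl, mul_comm]

lemma step_eq (q : Fin n → ℕ) (x : (Fin n → ℕ) × 𝒯 × ℝ) :
    X.step q x = fun i => q i + x.1 i - X.schedule q x i := rfl

/-- The second moment of the distance of the stationary queue lengths from the line of `c` is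
bounded in terms of the geometry of the capacity region and of a bound on the increments. -/
lemma lintegral_norm_perp_sq_le {A : ℕ} (hA : ∀ᵐ ω ∂P, ∀ i, X.arrival 0 ω i ≤ A)
    {c r : EuclideanSpace ℝ (Fin n)} (hc : ‖c‖ = 1) (hc0 : ∀ i, 0 ≤ c i) {ε δ : ℝ} (hδ : 0 < δ)
    (hl : ∀ i, ∫ ω, (X.arrival 0 ω i : ℝ) ∂P = r i - ε * c i) (hb : G.meanMaxRate c = ⟪c, r⟫)
    (hr : ∀ v, ⟪v, r⟫ + δ * ‖perp c v‖ ≤ G.meanMaxRate v)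
    {B D : ℝ} (hB : ∀ t, ∀ s ∈ G.S t, ‖natVec s‖ ≤ B)
    (hD : ‖natVec (fun _ : Fin n => A)‖ + 2 * B ≤ D)
    {π : Measure (Fin n → ℕ)} [IsProbabilityMeasure π]
    (hstat : (π.prod X.noiseLaw).map (fun p => X.step p.1 p.2) = π) :
    ∫⁻ q, ENNReal.ofReal (‖perp c (natVec q)‖ ^ 2) ∂π ≤
      ENNReal.ofReal (2 * D ^ 4 + (10 * D ^ 2 + 1) * ((10 * D ^ 2 + 1) / (4 * δ)) ^ 2) := by
  have hB0 : 0 ≤ B := by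
    obtain ⟨t, -⟩ := G.ψ.support_nonempty
    obtain ⟨s, hs⟩ := G.S_nonempty t
    exact (norm_nonneg _).trans (hB t s hs)
  have hD0 : 0 ≤ D := le_trans (by positivity) hD
  set w : (Fin n → ℕ) → ℝ := fun q => ‖perp c (natVec q)‖ with hw
  have w0 (q : Fin n → ℕ) : 0 ≤ w q := norm_nonneg _
  -- Twice `ξ` plus `D ^ 2` dominates the increment of `w ^ 2`: the actual `c`-weighted service is
  -- replaced by its maximum, so that the mean is expressed by support functions.
  let ξ : (Fin n → ℕ) → (Fin n → ℕ) × 𝒯 × ℝ → ℝ := fun q x =>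
    ⟪perp c (natVec q), natVec x.1⟫ - G.maxRate (natVec q) x.2.1 +
      ⟪c, natVec q⟫ * G.maxRate c x.2.1
  have iξ (q) : Integrable (ξ q) X.noiseLaw :=
    ((X.integrable_noise_arrival hA fun a => ⟪perp c (natVec q), natVec a⟫).sub
      (X.integrable_noise_channel (G.maxRate (natVec q)))).add
      ((X.integrable_noise_channel (G.maxRate c)).const_mul _)
  have hξ (q) : ∫ x, ξ q x ∂X.noiseLaw ≤ -(δ * w q) := by
    have e : ∫ x, ξ q x ∂X.noiseLaw =
        ⟪perp c (natVec q), r - ε • c⟫ - G.meanMaxRate (natVec q) +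
          ⟪c, natVec q⟫ * G.meanMaxRate c := by
      have hl' : ∀ i, ∫ ω, (X.arrival 0 ω i : ℝ) ∂P = (r - ε • c) i := by simpa using hl
      have i1 := X.integrable_noise_arrival hA fun a => ⟪perp c (natVec q), natVec a⟫
      have i2 := X.integrable_noise_channel (G.maxRate (natVec q))
      have i3 := (X.integrable_noise_channel (G.maxRate c)).const_mul ⟪c, natVec q⟫
      rw [← X.integral_inner_arrival hA hl', ← X.integral_maxRate, ← X.integral_maxRate,
        ← integral_const_mul, ← integral_sub i1 i2]
      exact integral_add (i1.sub i2) i3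
    rw [e, inner_sub_right, inner_smul_right, real_inner_comm c (perp c (natVec q)),
      inner_perp hc, perp_inner, hb]
    have := hr (natVec q)
    simp only [hw]
    linarith
  have hsched (q : Fin n → ℕ) (x : (Fin n → ℕ) × 𝒯 × ℝ) :
      X.schedule q x ∈ G.maxWeightSet q x.2.1 := X.select_mem _ _ _
  -- From `w'⁴ = w⁴ + 2w²(w'² - w²) + (w'² - w²)²`. The fourth power yields a drift of order `-w³`,
  -- enough to control the second moment.
  have hinc (q : Fin n → ℕ) : ∀ᵐ x ∂X.noiseLaw, w (X.step q x) ^ 4 ≤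
      w q ^ 4 + 2 * w q ^ 2 * (D ^ 2 + 2 * ξ q x) + (D * (2 * w q + D)) ^ 2 := by
    filter_upwards [X.ae_noise_arrival_le hA] with x hx
    set a := x.1
    set s := X.schedule q x with hs
    have hsm : s ∈ G.maxWeightSet q x.2.1 := hsched q x
    have n1 : ‖natVec a‖ ≤ ‖natVec (fun _ : Fin n => A)‖ := norm_natVec_le hx
    have n2 : ‖natVec s‖ ≤ B := hB _ _ hsm.1
    have n3 : ‖natVec a - natVec s‖ ≤ D := by
      have := norm_sub_le (natVec a) (natVec s); linarith
    have h1 := norm_perp_next_sq_le hc hc0 q a s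
    have h2 : ⟪natVec q, natVec a - natVec s⟫ - ⟪c, natVec q⟫ * ⟪c, natVec a - natVec s⟫ ≤
        ξ q x := by
      simp only [ξ, perp_inner]
      rw [inner_sub_right, inner_sub_right, G.inner_eq_maxRate_of_mem_maxWeightSet hsm]
      have := mul_le_mul_of_nonneg_left (G.inner_le_maxRate c hsm.1) (inner_natVec_nonneg hc0 q)
      linarith
    have h3 : |w (X.step q x) - w q| ≤ D := by
      refine (abs_norm_sub_norm_le _ _).trans ?_
      rw [← perp_sub]
      refine (norm_perp_le hc _).trans ?_
      rw [step_eq, natVec_next, ← hs]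
      have e : natVec q + (natVec a - natVec s) + natVec (unused q a s) - natVec q =
        (natVec a - natVec s) + natVec (unused q a s) := by abel
      rw [e]
      have := norm_add_le (natVec a - natVec s) (natVec (unused q a s))
      have := norm_sub_le (natVec a) (natVec s)
      have := norm_unused_le q a s
      linarith
    have h4 : w (X.step q x) ^ 2 ≤ w q ^ 2 + (D ^ 2 + 2 * ξ q x) := by
      have := pow_le_pow_left₀ (norm_nonneg _) n3 2
      have e : w (X.step q x) = ‖perp c (natVec (fun i => q i + a i - s i))‖ := rfl
      rw [e]; simp only [hw]; linarith
    have h5 : |w (X.step q x) ^ 2 - w q ^ 2| ≤ D * (2 * w q + D) := by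
      have e : w (X.step q x) ^ 2 - w q ^ 2 =
        (w (X.step q x) - w q) * (w (X.step q x) + w q) := by ring
      rw [e, abs_mul, abs_of_nonneg (add_nonneg (w0 _) (w0 q))]
      refine mul_le_mul h3 ?_ (add_nonneg (w0 _) (w0 q)) hD0
      linarith [(abs_le.1 h3).2]
    have h6 := sq_le_sq' (abs_le.1 h5).1 (abs_le.1 h5).2
    have h7 := mul_le_mul_of_nonneg_left h4 (by positivity : 0 ≤ 2 * w q ^ 2)
    nlinarith
  have iR (q : Fin n → ℕ) : Integrable (fun x =>
      w q ^ 4 + 2 * w q ^ 2 * (D ^ 2 + 2 * ξ q x) + (D * (2 * w q + D)) ^ 2) X.noiseLaw :=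
    ((integrable_const _).add (((integrable_const _).add ((iξ q).const_mul 2)).const_mul _)).add
      (integrable_const _)
  have mstep (q) : Measurable fun x => w (X.step q x) ^ 4 :=
    (measurable_of_countable fun q => w q ^ 4).comp (X.measurable_step.comp measurable_prodMk_left)
  have hint (q : Fin n → ℕ) : Integrable (fun x => w (X.step q x) ^ 4) X.noiseLaw := by
    refine (iR q).mono' (mstep q).aestronglyMeasurable ?_
    filter_upwards [hinc q] with x hx
    rwa [Real.norm_of_nonneg (by positivity)]
  refine lintegral_le_of_drift X.measurable_step hstat (V := fun q => w q ^ 4)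
    (measurable_of_countable _) (measurable_of_countable _) (fun q => by positivity)
    (fun q => by positivity) (by positivity) hint fun q => ?_
  have e : ∫ x, (w q ^ 4 + 2 * w q ^ 2 * (D ^ 2 + 2 * ξ q x) + (D * (2 * w q + D)) ^ 2)
      ∂X.noiseLaw = w q ^ 4 + 2 * w q ^ 2 * (D ^ 2 + 2 * ∫ x, ξ q x ∂X.noiseLaw) +
        (D * (2 * w q + D)) ^ 2 := by
    have e' (x) : w q ^ 4 + 2 * w q ^ 2 * (D ^ 2 + 2 * ξ q x) + (D * (2 * w q + D)) ^ 2 =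
        (w q ^ 4 + 2 * w q ^ 2 * D ^ 2 + (D * (2 * w q + D)) ^ 2) + 4 * w q ^ 2 * ξ q x := by ring
    simp_rw [e']
    rw [integral_add (integrable_const _) ((iξ q).const_mul _), integral_const_mul]
    simp only [integral_const, probReal_univ, one_smul]
    ring
  have h1 := (integral_mono_ae (hint q) (iR q) (hinc q)).trans_eq e
  have h2 := mul_le_mul_of_nonneg_left (hξ q) (by positivity : 0 ≤ 4 * w q ^ 2)
  refine h1.trans ?_
  -- The coefficient of `w ^ 2`: 2D² from the first-order term, 8D² from the squared increment, and
  -- 1 for the `w ^ 2` to be integrated. The cubic term wins once `w` exceeds `A' / (4 * δ)`.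
  set A' := 10 * D ^ 2 + 1 with hA'
  have hw0 := w0 q
  have h3 : A' * w q ^ 2 - 4 * δ * w q ^ 3 ≤ A' * (A' / (4 * δ)) ^ 2 := by
    have hA0 : 0 ≤ A' := by positivity
    rcases le_total (w q) (A' / (4 * δ)) with h | h
    · have : w q ^ 2 ≤ (A' / (4 * δ)) ^ 2 := by gcongr
      have := mul_le_mul_of_nonneg_left this hA0
      have : 0 ≤ 4 * δ * w q ^ 3 := by positivity
      linarith
    · rw [div_le_iff₀ (by positivity)] at h
      have := mul_le_mul_of_nonneg_left h (by positivity : 0 ≤ w q ^ 2)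
      have : 0 ≤ A' * (A' / (4 * δ)) ^ 2 := by positivity
      nlinarith
  have h4 : (D * (2 * w q + D)) ^ 2 ≤ D ^ 2 * (8 * w q ^ 2 + 2 * D ^ 2) := by
    rw [mul_pow]
    refine mul_le_mul_of_nonneg_left ?_ (sq_nonneg D)
    nlinarith [sq_nonneg (2 * w q - D)]
  change _ ≤ w q ^ 4 - w q ^ 2 + (2 * D ^ 4 + A' * (A' / (4 * δ)) ^ 2)
  rw [hA'] at h3 ⊢
  nlinarith

end GeneralizedSwitch.MaxWeightSystem

/-! ### The transform of the scaled queue length -/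

section Transform

open Complex

lemma norm_exp_I_mul_sub_one_sub_le {x : ℝ} (hx : |x| ≤ 1) :
    ‖cexp (I * x) - 1 - I * x‖ ≤ x ^ 2 := by
  have h : ‖I * (x : ℂ)‖ = |x| := by simp
  have := norm_exp_sub_one_sub_id_le (x := I * x) (by rwa [h])
  rwa [h, sq_abs] at this

lemma norm_exp_I_mul_sub_taylor_le {x : ℝ} (hx : |x| ≤ 1) :
    ‖cexp (I * x) - 1 - I * x + x ^ 2 / 2‖ ≤ |x| ^ 3 := by
  have h : ‖I * (x : ℂ)‖ = |x| := by simp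
  have := exp_bound (x := I * x) (by rwa [h]) (n := 3) (by norm_num)
  rw [h] at this
  simp only [Finset.sum_range_succ, Finset.range_zero, Finset.sum_empty, Nat.factorial,
    mul_pow, I_sq] at this
  refine le_trans (le_of_eq ?_) (this.trans ?_)
  · congr 1; push_cast; ring
  · refine mul_le_of_le_one_right (by positivity) ?_
    norm_num

/-- The increment of a complex exponential along one step of the queue. -/
lemma norm_exp_increment_le {a y y' z d v w w' D K : ℝ} (hy : 0 ≤ y) (hy' : 0 ≤ y') (hd : 0 ≤ d)
    (hdD : d ≤ D) (hv : 0 ≤ v) (hvD : v ≤ D) (hz : |z| ≤ D) (hstep : y' = y + (z + d) + v)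
    (hyd : y * d ≤ K * w * d) (hyv : y' * v ≤ K * w' * v) (ha : |a| * (2 * D) ≤ 1) :
    ‖cexp (I * (a * y' : ℝ)) - cexp (I * (a * y : ℝ)) -
      (I * a * (cexp (I * (a * y : ℝ)) * z) - a ^ 2 / 2 * (cexp (I * (a * y : ℝ)) * (z ^ 2 : ℝ)) +
        I * a * (d + v : ℝ))‖ ≤
      a ^ 2 * (K * (w * d + w' * v) + 2 * D * (d + v)) + 8 * |a| ^ 3 * D ^ 3 := by
  have hD : 0 ≤ D := hd.trans hdD
  set E := cexp (I * (a * y : ℝ)) with hE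
  set E' := cexp (I * (a * y' : ℝ)) with hE'
  have nE : ‖E‖ = 1 := norm_exp_I_mul_ofReal _
  have nE' : ‖E'‖ = 1 := norm_exp_I_mul_ofReal _
  have hx : |z + d| ≤ 2 * D := by
    rw [abs_le] at hz ⊢; constructor <;> linarith [hz.1, hz.2]
  have hax : |a * (z + d)| ≤ 1 := by
    rw [abs_mul]; exact (mul_le_mul_of_nonneg_left hx (abs_nonneg a)).trans ha
  have hav : |a * -v| ≤ 1 := by
    rw [abs_mul, abs_neg, abs_of_nonneg hv]
    exact (mul_le_mul_of_nonneg_left (by linarith) (abs_nonneg a)).trans ha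
  -- Both sides are the exponential at `y + z + d`, expanded forward from `y` and backward from
  -- `y'`. Thus `d` comes with the factor `E` and `v` with `E'`, matching the bounds on `y * d` and
  -- `y' * v`.
  have hfac : E' * cexp (I * (a * -v : ℝ)) = E * cexp (I * (a * (z + d) : ℝ)) := by
    rw [hE, hE', ← Complex.exp_add, ← Complex.exp_add, hstep]
    congr 1; push_cast; ring
  set T := cexp (I * (a * (z + d) : ℝ)) - 1 - I * (a * (z + d) : ℝ) +
    (a * (z + d) : ℝ) ^ 2 / 2 with hT
  set S := cexp (I * (a * -v : ℝ)) - 1 - I * (a * -v : ℝ) with hS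
  have nT : ‖T‖ ≤ |a * (z + d)| ^ 3 := norm_exp_I_mul_sub_taylor_le hax
  have nS : ‖S‖ ≤ (a * -v) ^ 2 := norm_exp_I_mul_sub_one_sub_le hav
  have n1 : ‖E - 1‖ ≤ |a| * y := by
    have := Real.norm_exp_I_mul_ofReal_sub_one_le (x := a * y)
    rwa [Real.norm_eq_abs, abs_mul, abs_of_nonneg hy] at this
  have n1' : ‖E' - 1‖ ≤ |a| * y' := by
    have := Real.norm_exp_I_mul_ofReal_sub_one_le (x := a * y')
    rwa [Real.norm_eq_abs, abs_mul, abs_of_nonneg hy'] at this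
  have hsplit : E' - E - (I * a * (E * z) - a ^ 2 / 2 * (E * (z ^ 2 : ℝ)) + I * a * (d + v : ℝ)) =
      E * T + (-(E' * S)) + I * a * ((E - 1) * d) + I * a * ((E' - 1) * v) +
        (-(a ^ 2 / 2 * (E * (2 * z * d + d ^ 2 : ℝ)))) := by
    have e1 : E' * S = E * (T + 1 + I * (a * (z + d) : ℝ) - (a * (z + d) : ℝ) ^ 2 / 2) -
        E' - E' * (I * (a * -v : ℝ)) := by
      rw [hS, hT, mul_sub, mul_sub, hfac]; ring
    rw [e1]; push_cast; ring
  rw [hsplit]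
  have b1 : ‖E * T‖ ≤ 8 * |a| ^ 3 * D ^ 3 := by
    rw [norm_mul, nE, one_mul]
    refine nT.trans ?_
    rw [abs_mul, mul_pow]
    have := pow_le_pow_left₀ (abs_nonneg _) hx 3
    calc |a| ^ 3 * |z + d| ^ 3 ≤ |a| ^ 3 * (2 * D) ^ 3 := by gcongr
      _ = _ := by ring
  have b2 : ‖-(E' * S)‖ ≤ a ^ 2 * (D * v) := by
    rw [norm_neg, norm_mul, nE', one_mul]
    refine nS.trans ?_
    rw [mul_pow, neg_sq, sq v]
    gcongr
  have b3 : ‖I * a * ((E - 1) * d)‖ ≤ a ^ 2 * (K * w * d) := by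
    simp only [norm_mul, norm_I, one_mul, norm_real, Real.norm_eq_abs, abs_of_nonneg hd]
    calc |a| * (‖E - 1‖ * d) ≤ |a| * ((|a| * y) * d) := by gcongr
      _ = |a| ^ 2 * (y * d) := by ring
      _ ≤ |a| ^ 2 * (K * w * d) := by gcongr
      _ = _ := by rw [sq_abs]
  have b4 : ‖I * a * ((E' - 1) * v)‖ ≤ a ^ 2 * (K * w' * v) := by
    simp only [norm_mul, norm_I, one_mul, norm_real, Real.norm_eq_abs, abs_of_nonneg hv]
    calc |a| * (‖E' - 1‖ * v) ≤ |a| * ((|a| * y') * v) := by gcongr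
      _ = |a| ^ 2 * (y' * v) := by ring
      _ ≤ |a| ^ 2 * (K * w' * v) := by gcongr
      _ = _ := by rw [sq_abs]
  have b5 : ‖-(a ^ 2 / 2 * (E * (2 * z * d + d ^ 2 : ℝ)))‖ ≤ a ^ 2 * (2 * D * d) := by
    rw [norm_neg, norm_mul, norm_mul, nE, one_mul, norm_real, Real.norm_eq_abs]
    have : ‖(a : ℂ) ^ 2 / 2‖ = a ^ 2 / 2 := by simp
    rw [this]
    have h : |2 * z * d + d ^ 2| ≤ 3 * D * d := by
      have e : 2 * z * d + d ^ 2 = (2 * z + d) * d := by ring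
      rw [e, abs_mul, abs_of_nonneg hd]
      refine mul_le_mul_of_nonneg_right ?_ hd
      rw [abs_le] at hz ⊢; constructor <;> linarith [hz.1, hz.2]
    have h' := mul_le_mul_of_nonneg_left h (by positivity : 0 ≤ a ^ 2 / 2)
    have : 0 ≤ a ^ 2 * (D * d) := by positivity
    linarith
  have hDv : 0 ≤ a ^ 2 * (D * v) := by positivity
  refine (norm_add_le_of_le (norm_add_le_of_le (norm_add_le_of_le (norm_add_le_of_le b1 b2) b3) b4)
    b5).trans ?_
  linarith

/-- The characteristic function of a stationary heavy-traffic queue length nearly satisfies the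
equation that determines the characteristic function of the exponential law. -/
lemma norm_transform_le {Ω : Type*} [MeasurableSpace Ω] {μ : Measure Ω} [IsProbabilityMeasure μ]
    {y y' z d v w w' : Ω → ℝ} {θ ε D K M : ℝ} (hε : 0 < ε) (hD : 0 ≤ D) (hK : 0 ≤ K)
    (my : Measurable y) (my' : Measurable y') (mz : Measurable z) (md : Measurable d)
    (mv : Measurable v)
    (hy : ∀ ω, 0 ≤ y ω) (hy' : ∀ ω, 0 ≤ y' ω) (hd : ∀ ω, 0 ≤ d ω) (hdD : ∀ ω, d ω ≤ D)
    (hv : ∀ ω, 0 ≤ v ω) (hvD : ∀ ω, v ω ≤ D) (hz : ∀ᵐ ω ∂μ, |z ω| ≤ D)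
    (hstep : ∀ ω, y' ω = y ω + (z ω + d ω) + v ω)
    (hyd : ∀ ω, y ω * d ω ≤ K * w ω * d ω) (hyv : ∀ ω, y' ω * v ω ≤ K * w' ω * v ω)
    (iw : Integrable (fun ω => w ω ^ 2) μ) (iw' : Integrable (fun ω => w' ω ^ 2) μ)
    (hw : ∫ ω, w ω ^ 2 ∂μ ≤ M) (hw' : ∫ ω, w' ω ^ 2 ∂μ ≤ M)
    (hEz : ∫ ω, z ω ∂μ = -ε) (hEdv : ∫ ω, d ω ∂μ + ∫ ω, v ω ∂μ = ε) (hind : IndepFun y z μ)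
    (hstat : ∫ ω, cexp (I * (θ * ε * y' ω : ℝ)) ∂μ = ∫ ω, cexp (I * (θ * ε * y ω : ℝ)) ∂μ)
    (hθ : |θ * ε| * (2 * D) ≤ 1) :
    ‖(∫ ω, cexp (I * (θ * ε * y ω : ℝ)) ∂μ) * (I * θ + θ ^ 2 / 2 * (∫ ω, z ω ^ 2 ∂μ : ℝ)) -
      I * θ‖ ≤ θ ^ 2 * (K * (1 + 2 * M * D) * √ε + 2 * D * ε) + 8 * |θ| ^ 3 * D ^ 3 * ε := by
  set a := θ * ε with ha
  set E : Ω → ℂ := fun ω => cexp (I * (a * y ω : ℝ)) with hE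
  set E' : Ω → ℂ := fun ω => cexp (I * (a * y' ω : ℝ)) with hE'
  set g : ℂ := ∫ ω, E ω ∂μ with hg
  set s := √ε with hs
  have hs0 : 0 < s := Real.sqrt_pos.2 hε
  have hss : s ^ 2 = ε := Real.sq_sqrt hε.le
  have mE : Measurable E := by fun_prop
  have mE' : Measurable E' := by fun_prop
  have nE (ω) : ‖E ω‖ = 1 := norm_exp_I_mul_ofReal _
  have nE' (ω) : ‖E' ω‖ = 1 := norm_exp_I_mul_ofReal _
  have iE : Integrable E μ := Integrable.of_bound mE.aestronglyMeasurable 1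
    (Eventually.of_forall fun ω => (nE ω).le)
  have iE' : Integrable E' μ := Integrable.of_bound mE'.aestronglyMeasurable 1
    (Eventually.of_forall fun ω => (nE' ω).le)
  have id : Integrable d μ := Integrable.of_bound md.aestronglyMeasurable D
    (Eventually.of_forall fun ω => by rw [Real.norm_of_nonneg (hd ω)]; exact hdD ω)
  have iv : Integrable v μ := Integrable.of_bound mv.aestronglyMeasurable D
    (Eventually.of_forall fun ω => by rw [Real.norm_of_nonneg (hv ω)]; exact hvD ω)
  have iEz : Integrable (fun ω => E ω * (z ω : ℂ)) μ :=
    Integrable.of_bound (by fun_prop) D (by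
      filter_upwards [hz] with ω h
      rwa [norm_mul, nE, one_mul, norm_real, Real.norm_eq_abs])
  have iEz2 : Integrable (fun ω => E ω * ((z ω ^ 2 : ℝ) : ℂ)) μ :=
    Integrable.of_bound (by fun_prop) (D ^ 2) (by
      filter_upwards [hz] with ω h
      rw [norm_mul, nE, one_mul, norm_real, Real.norm_eq_abs, abs_pow]
      gcongr)
  have hEz1 : ∫ ω, E ω * (z ω : ℂ) ∂μ = g * (-ε : ℝ) := by
    have h := hind.comp (φ := fun x : ℝ => cexp (I * (a * x : ℝ))) (ψ := fun x : ℝ => (x : ℂ))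
      (by fun_prop) (by fun_prop)
    have := h.integral_fun_mul_eq_mul_integral (by fun_prop) (by fun_prop)
    rw [← hEz, ← integral_complex_ofReal]
    exact this
  have hEz2 : ∫ ω, E ω * ((z ω ^ 2 : ℝ) : ℂ) ∂μ = g * (∫ ω, z ω ^ 2 ∂μ : ℝ) := by
    have h := hind.comp (φ := fun x : ℝ => cexp (I * (a * x : ℝ)))
      (ψ := fun x : ℝ => ((x ^ 2 : ℝ) : ℂ)) (by fun_prop) (by fun_prop)
    have := h.integral_fun_mul_eq_mul_integral (by fun_prop) (by fun_prop)
    rw [← integral_complex_ofReal]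
    exact this
  set F : Ω → ℂ := fun ω => E' ω - E ω - (I * a * (E ω * z ω) -
    a ^ 2 / 2 * (E ω * (z ω ^ 2 : ℝ)) + I * a * (d ω + v ω : ℝ)) with hF
  have idv : Integrable (fun ω => ((d ω + v ω : ℝ) : ℂ)) μ := (id.add iv).ofReal
  -- Stationarity cancels the exponentials, and every remaining term has order ε²: one ε comes from
  -- `a`, the other from `a` again or from a mean equal to ±ε.
  have hFint : ∫ ω, F ω ∂μ =
      ε ^ 2 * (g * (I * θ + θ ^ 2 / 2 * (∫ ω, z ω ^ 2 ∂μ : ℝ)) - I * θ) := by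
    have j1 : Integrable (fun ω => I * a * (E ω * z ω)) μ := iEz.const_mul _
    have j2 : Integrable (fun ω => (a : ℂ) ^ 2 / 2 * (E ω * (z ω ^ 2 : ℝ))) μ := iEz2.const_mul _
    have j3 : Integrable (fun ω => I * a * (d ω + v ω : ℝ)) μ := idv.const_mul _
    have e1 : ∫ ω, F ω ∂μ = (∫ ω, E' ω ∂μ - g) -
        ((∫ ω, I * a * (E ω * z ω) ∂μ - ∫ ω, (a : ℂ) ^ 2 / 2 * (E ω * (z ω ^ 2 : ℝ)) ∂μ) +
          ∫ ω, I * a * (d ω + v ω : ℝ) ∂μ) := by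
      rw [hg, ← integral_sub iE' iE, ← integral_sub j1 j2]
      have k1 := integral_add (j1.sub j2) j3
      have k2 := integral_sub (iE'.sub iE) ((j1.sub j2).add j3)
      simp only [Pi.sub_apply, Pi.add_apply] at k1 k2
      rw [← k1, ← k2]
    have hstat' : ∫ ω, E' ω ∂μ = g := hstat
    rw [e1, hstat', integral_const_mul, integral_const_mul, integral_const_mul, hEz1, hEz2,
      integral_complex_ofReal, integral_add id iv, hEdv, ha]
    push_cast
    ring
  set b : Ω → ℝ := fun ω => a ^ 2 * (K * (s⁻¹ * (d ω + v ω) + D * s * (w ω ^ 2 + w' ω ^ 2)) +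
    2 * D * (d ω + v ω)) + 8 * |a| ^ 3 * D ^ 3 with hb
  have hle : ∀ᵐ ω ∂μ, ‖F ω‖ ≤ b ω := by
    filter_upwards [hz] with ω hzω
    refine (norm_exp_increment_le (hy ω) (hy' ω) (hd ω) (hdD ω) (hv ω) (hvD ω) hzω (hstep ω)
      (hyd ω) (hyv ω) hθ).trans ?_
    -- A weighted Young inequality. The weight `s = √ε` balances E(d + v) = ε against the bounded
    -- second moments, so that both contributions are O(√ε).
    have key (p x : ℝ) (hx : 0 ≤ x) (hxD : x ≤ D) : p * x ≤ s⁻¹ * x + D * s * p ^ 2 := by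
      have h1 : p ≤ s⁻¹ + s * p ^ 2 := by
        have : 0 ≤ s⁻¹ * ((s * p - 1) ^ 2 + (s * p) ^ 2) := by positivity
        have e : s⁻¹ * ((s * p - 1) ^ 2 + (s * p) ^ 2) =
          2 * (s * p ^ 2) - 2 * p + s⁻¹ := by field_simp; ring
        have : 0 < s⁻¹ := by positivity
        linarith
      have h2 := mul_le_mul_of_nonneg_right h1 hx
      have h3 := mul_le_mul_of_nonneg_left hxD (by positivity : 0 ≤ s * p ^ 2)
      linarith
    have k1 := key (w ω) (d ω) (hd ω) (hdD ω)
    have k2 := key (w' ω) (v ω) (hv ω) (hvD ω)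
    have k3 : w ω * d ω + w' ω * v ω ≤
        s⁻¹ * (d ω + v ω) + D * s * (w ω ^ 2 + w' ω ^ 2) := by linarith
    simp only [hb]
    have k4 := mul_le_mul_of_nonneg_left (mul_le_mul_of_nonneg_left k3 hK) (sq_nonneg a)
    linarith
  have k1 : Integrable (fun ω => d ω + v ω) μ := id.add iv
  have k2 : Integrable (fun ω => w ω ^ 2 + w' ω ^ 2) μ := iw.add iw'
  have ib : Integrable b μ :=
    ((((k1.const_mul _).add (k2.const_mul _)).const_mul _ |>.add (k1.const_mul _)).const_mul _).add
      (integrable_const _)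
  have hbint : ∫ ω, b ω ∂μ ≤ a ^ 2 * (K * (s⁻¹ * ε + D * s * (M + M)) + 2 * D * ε) +
      8 * |a| ^ 3 * D ^ 3 := by
    have e1 (ω) : b ω = 8 * |a| ^ 3 * D ^ 3 + (a ^ 2 * (K * s⁻¹ + 2 * D) * (d ω + v ω) +
      a ^ 2 * K * D * s * (w ω ^ 2 + w' ω ^ 2)) := by simp only [hb]; ring
    have e2 : ∫ ω, b ω ∂μ = 8 * |a| ^ 3 * D ^ 3 + (a ^ 2 * (K * s⁻¹ + 2 * D) * ε +
      a ^ 2 * K * D * s * (∫ ω, w ω ^ 2 ∂μ + ∫ ω, w' ω ^ 2 ∂μ)) := by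
      have k3 : Integrable (fun ω => a ^ 2 * (K * s⁻¹ + 2 * D) * (d ω + v ω) +
          a ^ 2 * K * D * s * (w ω ^ 2 + w' ω ^ 2)) μ := (k1.const_mul _).add (k2.const_mul _)
      simp_rw [e1]
      rw [integral_add (integrable_const _) k3,
        integral_add (k1.const_mul _) (k2.const_mul _)]
      simp only [integral_const_mul]
      rw [integral_add id iv, integral_add iw iw', hEdv]
      simp
    have h1 : a ^ 2 * K * D * s * (∫ ω, w ω ^ 2 ∂μ + ∫ ω, w' ω ^ 2 ∂μ) ≤
        a ^ 2 * K * D * s * (M + M) := by gcongr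
    rw [e2]; linarith
  have hfin : ‖∫ ω, F ω ∂μ‖ ≤ a ^ 2 * (K * (s⁻¹ * ε + D * s * (M + M)) + 2 * D * ε) +
      8 * |a| ^ 3 * D ^ 3 := (norm_integral_le_of_norm_le ib hle).trans hbint
  rw [hFint, norm_mul] at hfin
  have e3 : ‖(ε : ℂ) ^ 2‖ = ε ^ 2 := by simp
  have e4 : s⁻¹ * ε = s := by rw [← hss]; field_simp
  have e5 : a ^ 2 * (K * (s⁻¹ * ε + D * s * (M + M)) + 2 * D * ε) + 8 * |a| ^ 3 * D ^ 3 =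
      ε ^ 2 * (θ ^ 2 * (K * (1 + 2 * M * D) * s + 2 * D * ε) + 8 * |θ| ^ 3 * D ^ 3 * ε) := by
    rw [e4, ha, abs_mul, abs_of_pos hε]; ring
  rw [e3, e5] at hfin
  exact le_of_mul_le_mul_left hfin (by positivity)

end Transform

lemma MeasureTheory.MeasurePreserving.integral_comp_eq {α β E : Type*} [MeasurableSpace α]
    [MeasurableSpace β] [NormedAddCommGroup E] [NormedSpace ℝ E] {μ : Measure α} {ν : Measure β}
    {f : α → β} (hf : MeasurePreserving f μ ν) {g : β → E} (hg : AEStronglyMeasurable g ν) :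
    ∫ x, g (f x) ∂μ = ∫ x, g x ∂ν := by
  rw [← hf.map_eq] at hg ⊢
  exact (integral_map hf.aemeasurable hg).symm

/-! ### The exponential law -/

lemma integral_exp_expMeasure {r : ℝ} (hr : 0 < r) (θ : ℝ) :
    ∫ x, Complex.exp (Complex.I * (θ * x : ℝ)) ∂(expMeasure r) =
      r / (r - Complex.I * θ) := by
  have hre : (-(r - Complex.I * θ) : ℂ).re < 0 := by simpa using hr
  have hne : (r - Complex.I * θ : ℂ) ≠ 0 := by
    intro h
    rw [h] at hre
    simp at hre
  have mpdf : Measurable (exponentialPDF r) := (measurable_exponentialPDFReal r).ennreal_ofReal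
  have h0 : expMeasure r = volume.withDensity (exponentialPDF r) := rfl
  rw [h0, integral_withDensity_eq_integral_toReal_smul mpdf
    (Eventually.of_forall fun x => ENNReal.ofReal_lt_top)]
  have h1 : ∀ x, (exponentialPDF r x).toReal • Complex.exp (Complex.I * (θ * x : ℝ)) =
      (Set.Ici (0 : ℝ)).indicator
        (fun x : ℝ => (r : ℂ) * Complex.exp (-(r - Complex.I * θ) * x)) x := by
    intro x
    by_cases hx : 0 ≤ x
    · rw [Set.indicator_of_mem (Set.mem_Ici.2 hx), exponentialPDF_eq, if_pos hx,
        ENNReal.toReal_ofReal (by positivity), Complex.real_smul]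
      push_cast
      rw [mul_assoc, ← Complex.exp_add]
      congr 2; ring
    · rw [Set.indicator_of_notMem (by simpa using hx), exponentialPDF_eq, if_neg hx]
      simp
  simp_rw [h1]
  rw [integral_indicator measurableSet_Ici, integral_Ici_eq_integral_Ioi, integral_const_mul,
    integral_exp_mul_complex_Ioi hre]
  simp only [Complex.ofReal_zero, mul_zero, Complex.exp_zero]
  field_simp

/-- The usual 1 / (1 - iθm), written as the solution of the transform equation; for θ ≠ 0 this form
also covers the point mass `m = 0`. -/
lemma integral_exp_exponentialWithMean {m : ℝ} (hm : 0 ≤ m) {θ : ℝ} (hθ : θ ≠ 0) :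
    ∫ x, Complex.exp (Complex.I * (θ * x : ℝ)) ∂(exponentialWithMean m) =
      Complex.I * θ / (Complex.I * θ + θ ^ 2 * m) := by
  have hθ' : (θ : ℂ) ≠ 0 := by exact_mod_cast hθ
  have hI : Complex.I * (θ : ℂ) ≠ 0 := mul_ne_zero Complex.I_ne_zero hθ'
  unfold exponentialWithMean
  rcases hm.eq_or_lt with rfl | hm
  · simp [div_self hI]
  · rw [if_neg hm.ne', integral_exp_expMeasure (inv_pos.2 hm)]
    have hm' : (m : ℂ) ≠ 0 := by exact_mod_cast hm.ne'
    have n1 : ((m⁻¹ : ℝ) - Complex.I * θ : ℂ) ≠ 0 := fun h => by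
      have := congrArg Complex.re h
      simp [hm.ne'] at this
    have n2 : (Complex.I * θ + θ ^ 2 * m : ℂ) ≠ 0 := fun h => by
      have := congrArg Complex.im h
      simp [← Complex.ofReal_pow, hθ] at this
    rw [div_eq_div_iff n1 n2]
    push_cast
    field_simp
    ring_nf
    simp

/-- The mean increment of a nonnegative function along a stationary chain is zero, if the
increments are bounded. -/
lemma integral_increment_eq_zero {Q N : Type*} [MeasurableSpace Q] [MeasurableSpace N]
    {π : Measure Q} {ν : Measure N} [IsProbabilityMeasure π] [IsProbabilityMeasure ν]
    {Φ : Q → N → Q} (mΦ : Measurable (fun p : Q × N => Φ p.1 p.2))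
    (hstat : (π.prod ν).map (fun p => Φ p.1 p.2) = π) {f : Q → ℝ} (mf : Measurable f)
    (hf : ∀ q, 0 ≤ f q) {D : ℝ} (hD : ∀ᵐ p ∂(π.prod ν), |f (Φ p.1 p.2) - f p.1| ≤ D) :
    ∫ p, (f (Φ p.1 p.2) - f p.1) ∂(π.prod ν) = 0 := by
  -- `f` itself may fail to be integrable. Truncation is 1-Lipschitz, so the truncated increments
  -- keep the bound `D` and dominated convergence applies.
  set F : ℕ → Q × N → ℝ := fun R p => min (f (Φ p.1 p.2)) R - min (f p.1) R with hF
  have mfΦ : Measurable fun p : Q × N => f (Φ p.1 p.2) := mf.comp mΦ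
  have iV (R : ℕ) : Integrable (fun q => min (f q) (R : ℝ)) π :=
    Integrable.of_bound (by fun_prop) R (Eventually.of_forall fun q => by
      rw [Real.norm_of_nonneg (le_min (hf q) R.cast_nonneg)]; exact min_le_right _ _)
  have hF0 (R : ℕ) : ∫ p, F R p ∂(π.prod ν) = 0 := by
    have p1 : MeasurePreserving (fun p : Q × N => Φ p.1 p.2) (π.prod ν) π := ⟨mΦ, hstat⟩
    have p2 : MeasurePreserving (Prod.fst : Q × N → Q) (π.prod ν) π := measurePreserving_fst
    have mV : Measurable fun q => min (f q) (R : ℝ) := by fun_prop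
    have e1 : ∫ p, min (f (Φ p.1 p.2)) (R : ℝ) ∂(π.prod ν) = ∫ q, min (f q) (R : ℝ) ∂π :=
      p1.integral_comp_eq mV.aestronglyMeasurable
    have e2 : ∫ p : Q × N, min (f p.1) (R : ℝ) ∂(π.prod ν) = ∫ q, min (f q) (R : ℝ) ∂π :=
      p2.integral_comp_eq mV.aestronglyMeasurable
    have := integral_sub ((p1.integrable_comp mV.aestronglyMeasurable).2 (iV R))
      ((p2.integrable_comp mV.aestronglyMeasurable).2 (iV R))
    refine this.trans ?_
    simp only [Function.comp_def]
    rw [e1, e2, sub_self]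
  have lim : Tendsto (fun R => ∫ p, F R p ∂(π.prod ν)) atTop
      (𝓝 (∫ p, (f (Φ p.1 p.2) - f p.1) ∂(π.prod ν))) := by
    refine tendsto_integral_of_dominated_convergence (fun _ => D)
      (fun R => (by fun_prop : Measurable (F R)).aestronglyMeasurable)
      (integrable_const D) (fun R => ?_) ?_
    · filter_upwards [hD] with p hp
      refine le_trans ?_ hp
      have := abs_min_sub_min_le_max (f (Φ p.1 p.2)) R (f p.1) R
      simpa using this
    · refine Eventually.of_forall fun p => tendsto_const_nhds.congr' ?_
      filter_upwards [(tendsto_natCast_atTop_atTop (R := ℝ)).eventually_ge_atTop (f (Φ p.1 p.2)),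
        (tendsto_natCast_atTop_atTop (R := ℝ)).eventually_ge_atTop (f p.1)] with R h1 h2
      simp only [hF, min_eq_left h1, min_eq_left h2]
  simp only [hF0] at lim
  exact tendsto_nhds_unique lim tendsto_const_nhds

/-! ### The transform of the queue length of the switch -/

namespace GeneralizedSwitch.MaxWeightSystem

variable {n : ℕ} {𝒯 : Type*} [Fintype 𝒯] [MeasurableSpace 𝒯] [DiscreteMeasurableSpace 𝒯]
  {G : GeneralizedSwitch n 𝒯} {Ω : Type*} [MeasurableSpace Ω] {P : Measure Ω}
  [IsProbabilityMeasure P] (X : G.MaxWeightSystem P)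

/-- The variance of the `c`-weighted arrivals. -/
lemma variance_inner_arrival {A : ℕ} (hA : ∀ᵐ ω ∂P, ∀ i, X.arrival 0 ω i ≤ A)
    (c : EuclideanSpace ℝ (Fin n)) :
    Var[fun ω => ⟪c, natVec (X.arrival 0 ω)⟫; P] = ∑ i, ∑ j, c i * c j *
      cov[fun ω => (X.arrival 0 ω i : ℝ), fun ω => (X.arrival 0 ω j : ℝ); P] := by
  have ma (i : Fin n) : MemLp (fun ω => (X.arrival 0 ω i : ℝ)) 2 P := by
    have mm : Measurable fun ω => (X.arrival 0 ω i : ℝ) :=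
      (measurable_of_countable (fun a : Fin n → ℕ => (a i : ℝ))).comp (X.measurable_arrival 0)
    refine MemLp.of_bound mm.aestronglyMeasurable A ?_
    filter_upwards [hA] with ω h
    simpa using h i
  simp_rw [inner_natVec]
  rw [variance_fun_sum fun i => (ma i).const_mul (c i)]
  simp_rw [covariance_const_mul_left, covariance_const_mul_right, mul_assoc]

/-- The second moment of the `c`-weighted net input in one slot. -/
lemma integral_net_input_sq {A : ℕ} (hA : ∀ᵐ ω ∂P, ∀ i, X.arrival 0 ω i ≤ A)
    (c : EuclideanSpace ℝ (Fin n)) :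
    ∫ x, (⟪c, natVec x.1⟫ - G.maxRate c x.2.1) ^ 2 ∂X.noiseLaw =
      ∑ i, ∑ j, c i * c j * cov[fun ω => (X.arrival 0 ω i : ℝ),
        fun ω => (X.arrival 0 ω j : ℝ); P] + G.maxRateVariance c +
        (∫ x, (⟪c, natVec x.1⟫ - G.maxRate c x.2.1) ∂X.noiseLaw) ^ 2 := by
  set f : (Fin n → ℕ) → ℝ := fun a => ⟪c, natVec a⟫ with hf
  have mf : Measurable f := measurable_of_countable f
  have mh : Measurable (G.maxRate c) := Measurable.of_discrete
  have m1 : MemLp (fun x : (Fin n → ℕ) × 𝒯 × ℝ => f x.1) 2 X.noiseLaw :=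
    (memLp_two_iff_integrable_sq (mf.comp measurable_fst).aestronglyMeasurable).2
      (X.integrable_noise_arrival hA fun a => f a ^ 2)
  have m2 : MemLp (fun x : (Fin n → ℕ) × 𝒯 × ℝ => G.maxRate c x.2.1) 2 X.noiseLaw :=
    (memLp_two_iff_integrable_sq
      (mh.comp (measurable_fst.comp measurable_snd)).aestronglyMeasurable).2
      (X.integrable_noise_channel fun t => G.maxRate c t ^ 2)
  have hv := variance_eq_sub (m1.sub m2)
  have hind : IndepFun (fun x : (Fin n → ℕ) × 𝒯 × ℝ => f x.1)
      (fun x => G.maxRate c x.2.1) X.noiseLaw :=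
    indepFun_prod (X := f) (Y := fun x : 𝒯 × ℝ => G.maxRate c x.1) mf (mh.comp measurable_fst)
  have hs : Var[(fun x : (Fin n → ℕ) × 𝒯 × ℝ => f x.1) - (fun x => G.maxRate c x.2.1);
      X.noiseLaw] = Var[fun x => f x.1; X.noiseLaw] + Var[fun x => G.maxRate c x.2.1; X.noiseLaw] := by
    rw [variance_sub m1 m2, hind.covariance_eq_zero m1 m2]; ring
  have h1 : Var[fun x => f x.1; X.noiseLaw] = ∑ i, ∑ j, c i * c j *
      cov[fun ω => (X.arrival 0 ω i : ℝ), fun ω => (X.arrival 0 ω j : ℝ); P] := by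
    have e1 : Var[fun x => f x.1; X.noiseLaw] = Var[fun ω => f (X.arrival 0 ω); P] :=
      (X.measurePreserving_noise_arrival.variance_fun_comp mf.aemeasurable).trans
        (variance_map mf.aemeasurable (X.measurable_arrival 0).aemeasurable)
    rw [e1]
    exact X.variance_inner_arrival hA c
  have h2 : Var[fun x => G.maxRate c x.2.1; X.noiseLaw] = G.maxRateVariance c :=
    X.measurePreserving_noise_channel.variance_fun_comp mh.aemeasurable
  have hv' : Var[(fun x : (Fin n → ℕ) × 𝒯 × ℝ => f x.1) - (fun x => G.maxRate c x.2.1);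
      X.noiseLaw] = ∫ x, (f x.1 - G.maxRate c x.2.1) ^ 2 ∂X.noiseLaw -
        (∫ x, (f x.1 - G.maxRate c x.2.1) ∂X.noiseLaw) ^ 2 := hv
  rw [← h1, ← h2, ← hs, hv']
  ring

lemma measurable_unused : Measurable (fun p : (Fin n → ℕ) × (Fin n → ℕ) × 𝒯 × ℝ =>
    unused p.1 p.2.1 (X.schedule p.1 p.2)) := by
  have h : Measurable (fun p : (Fin n → ℕ) × (Fin n → ℕ) × (Fin n → ℕ) =>
      unused p.1 p.2.1 p.2.2) := measurable_of_countable _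
  exact h.comp (measurable_fst.prodMk
    ((measurable_fst.comp measurable_snd).prodMk X.measurable_schedule))

/-- The transform of the stationary `c`-weighted queue length nearly satisfies the equation that
determines the characteristic function of the exponential law. -/
lemma norm_transform_queue_le {A : ℕ} (hA : ∀ᵐ ω ∂P, ∀ i, X.arrival 0 ω i ≤ A)
    {c r : EuclideanSpace ℝ (Fin n)} (hc : ‖c‖ = 1) (hc0 : ∀ i, 0 ≤ c i) {ε : ℝ} (hε : 0 < ε)
    (hl : ∀ i, ∫ ω, (X.arrival 0 ω i : ℝ) ∂P = r i - ε * c i) (hb : G.meanMaxRate c = ⟪c, r⟫)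
    {B D K₁ K₂ M : ℝ} (hB : ∀ t, ∀ s ∈ G.S t, ‖natVec s‖ ≤ B)
    (hD : ‖natVec (fun _ : Fin n => A)‖ + 2 * B ≤ D) (hK₁ : ∀ i, (c i)⁻¹ ≤ K₁)
    (hK₂ : ∀ t, ∀ s ∈ G.S t, (G.maxRate c t - ⟪c, natVec s⟫)⁻¹ ≤ K₂)
    {π : Measure (Fin n → ℕ)} [IsProbabilityMeasure π]
    (hstat : (π.prod X.noiseLaw).map (fun p => X.step p.1 p.2) = π)
    (iw : Integrable (fun q => ‖perp c (natVec q)‖ ^ 2) π)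
    (hw : ∫ q, ‖perp c (natVec q)‖ ^ 2 ∂π ≤ M) {θ : ℝ} (hθ : |θ * ε| * (2 * D) ≤ 1) :
    ‖(∫ q, Complex.exp (Complex.I * (θ * ε * ⟪c, natVec q⟫ : ℝ)) ∂π) *
        (Complex.I * θ + θ ^ 2 / 2 * (∑ i, ∑ j, c i * c j * cov[fun ω => (X.arrival 0 ω i : ℝ),
          fun ω => (X.arrival 0 ω j : ℝ); P] + G.maxRateVariance c + ε ^ 2 : ℝ)) -
        Complex.I * θ‖ ≤
      θ ^ 2 * (max K₁ (2 * B * K₂) * (1 + 2 * M * D) * √ε + 2 * D * ε) +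
        8 * |θ| ^ 3 * D ^ 3 * ε := by
  have hB0 : 0 ≤ B := by
    obtain ⟨t, -⟩ := G.ψ.support_nonempty
    obtain ⟨s, hs⟩ := G.S_nonempty t
    exact (norm_nonneg _).trans (hB t s hs)
  have hA0 := norm_nonneg (natVec (fun _ : Fin n => A))
  have hD0 : 0 ≤ D := le_trans (by positivity) hD
  have hK : 0 ≤ max K₁ (2 * B * K₂) := by
    rcases isEmpty_or_nonempty (Fin n) with h | ⟨⟨i⟩⟩
    · exact absurd hc (by simp [EuclideanSpace.norm_eq])
    · exact le_max_of_le_left ((inv_nonneg.2 (hc0 i)).trans (hK₁ i))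
  have hsched (q : Fin n → ℕ) (x : (Fin n → ℕ) × 𝒯 × ℝ) :
      X.schedule q x ∈ G.maxWeightSet q x.2.1 := X.select_mem _ _ _
  have inner_le (x : EuclideanSpace ℝ (Fin n)) : |⟪c, x⟫| ≤ ‖x‖ := by
    simpa [hc] using abs_real_inner_le_norm c x
  have rate_le (t : 𝒯) : |G.maxRate c t| ≤ B := by
    obtain ⟨s, hs, e⟩ := G.exists_inner_eq_maxRate c t
    rw [← e]; exact (inner_le _).trans (hB t s hs)
  let Y : (Fin n → ℕ) × (Fin n → ℕ) × 𝒯 × ℝ → ℝ := fun p => ⟪c, natVec p.1⟫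
  let Y' : (Fin n → ℕ) × (Fin n → ℕ) × 𝒯 × ℝ → ℝ := fun p => ⟪c, natVec (X.step p.1 p.2)⟫
  let Z : (Fin n → ℕ) × (Fin n → ℕ) × 𝒯 × ℝ → ℝ := fun p =>
    ⟪c, natVec p.2.1⟫ - G.maxRate c p.2.2.1
  let δ : (Fin n → ℕ) × (Fin n → ℕ) × 𝒯 × ℝ → ℝ := fun p =>
    G.maxRate c p.2.2.1 - ⟪c, natVec (X.schedule p.1 p.2)⟫
  let V : (Fin n → ℕ) × (Fin n → ℕ) × 𝒯 × ℝ → ℝ := fun p =>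
    ⟪c, natVec (unused p.1 p.2.1 (X.schedule p.1 p.2))⟫
  let W : (Fin n → ℕ) × (Fin n → ℕ) × 𝒯 × ℝ → ℝ := fun p => ‖perp c (natVec p.1)‖
  let W' : (Fin n → ℕ) × (Fin n → ℕ) × 𝒯 × ℝ → ℝ := fun p =>
    ‖perp c (natVec (X.step p.1 p.2))‖
  have mc : Measurable fun q : Fin n → ℕ => ⟪c, natVec q⟫ := measurable_of_countable _
  have mrate : Measurable (G.maxRate c) := Measurable.of_discrete
  have mY : Measurable Y := mc.comp measurable_fst
  have mY' : Measurable Y' := mc.comp X.measurable_step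
  have mz : Measurable fun x : (Fin n → ℕ) × 𝒯 × ℝ => ⟪c, natVec x.1⟫ - G.maxRate c x.2.1 :=
    (mc.comp measurable_fst).sub (mrate.comp (measurable_fst.comp measurable_snd))
  have mZ : Measurable Z := mz.comp measurable_snd
  have mδ : Measurable δ :=
    (mrate.comp (measurable_fst.comp (measurable_snd.comp measurable_snd))).sub
      (mc.comp X.measurable_schedule)
  have mV : Measurable V := mc.comp X.measurable_unused
  have hstep (p) : Y' p = Y p + (Z p + δ p) + V p := by
    simp only [Y', Y, Z, δ, V]
    rw [step_eq, natVec_next, inner_add_right, inner_add_right, inner_sub_right]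
    ring
  have hδ0 (p) : 0 ≤ δ p := sub_nonneg.2 (G.inner_le_maxRate c (hsched p.1 p.2).1)
  have hδD (p) : δ p ≤ D := by
    have h1 := (abs_le.1 (rate_le p.2.2.1)).2
    have h2 := inner_natVec_nonneg hc0 (X.schedule p.1 p.2)
    simp only [δ]; linarith
  have hV0 (p) : 0 ≤ V p := inner_natVec_nonneg hc0 _
  have hVD (p) : V p ≤ D := by
    have h1 := (abs_le.1 (inner_le (natVec (unused p.1 p.2.1 (X.schedule p.1 p.2))))).2
    have h2 := norm_unused_le p.1 p.2.1 (X.schedule p.1 p.2)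
    have h3 := hB _ _ (hsched p.1 p.2).1
    simp only [V]; linarith
  have hzD : ∀ᵐ x ∂X.noiseLaw, |⟪c, natVec x.1⟫ - G.maxRate c x.2.1| ≤ D := by
    filter_upwards [X.ae_noise_arrival_le hA] with x hx
    have h1 := (inner_le (natVec x.1)).trans (norm_natVec_le hx)
    have h2 := rate_le x.2.1
    have h3 := abs_sub ⟪c, natVec x.1⟫ (G.maxRate c x.2.1)
    linarith
  have hZD : ∀ᵐ p ∂(π.prod X.noiseLaw), |Z p| ≤ D :=
    (measurePreserving_snd (μ := π) (ν := X.noiseLaw)).quasiMeasurePreserving.ae hzD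
  have iz : Integrable (fun x : (Fin n → ℕ) × 𝒯 × ℝ => ⟪c, natVec x.1⟫ - G.maxRate c x.2.1)
      X.noiseLaw := (X.integrable_noise_arrival hA fun a => ⟪c, natVec a⟫).sub
        (X.integrable_noise_channel (G.maxRate c))
  have psnd : MeasurePreserving (Prod.snd : (Fin n → ℕ) × (Fin n → ℕ) × 𝒯 × ℝ → _)
      (π.prod X.noiseLaw) X.noiseLaw := measurePreserving_snd
  have pfst : MeasurePreserving (Prod.fst : (Fin n → ℕ) × (Fin n → ℕ) × 𝒯 × ℝ → _)
      (π.prod X.noiseLaw) π := measurePreserving_fst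
  have pstep : MeasurePreserving (fun p => X.step p.1 p.2) (π.prod X.noiseLaw) π :=
    ⟨X.measurable_step, hstat⟩
  have hz : ∫ x, (⟪c, natVec x.1⟫ - G.maxRate c x.2.1) ∂X.noiseLaw = -ε := by
    have hl' : ∀ i, ∫ ω, (X.arrival 0 ω i : ℝ) ∂P = (r - ε • c) i := by simpa using hl
    rw [integral_sub (X.integrable_noise_arrival hA fun a => ⟪c, natVec a⟫)
      (X.integrable_noise_channel (G.maxRate c)), X.integral_inner_arrival hA hl',
      X.integral_maxRate, hb, inner_sub_right, inner_smul_right, real_inner_self_eq_norm_sq, hc]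
    ring
  have hZ : ∫ p, Z p ∂(π.prod X.noiseLaw) = -ε := by
    rw [← hz]
    exact psnd.integral_comp_eq mz.aestronglyMeasurable
  have hZ2 : ∫ p, Z p ^ 2 ∂(π.prod X.noiseLaw) =
      ∑ i, ∑ j, c i * c j * cov[fun ω => (X.arrival 0 ω i : ℝ),
          fun ω => (X.arrival 0 ω j : ℝ); P] + G.maxRateVariance c + ε ^ 2 := by
    have h1 := X.integral_net_input_sq hA c
    rw [hz, neg_sq] at h1
    rw [← h1]
    exact psnd.integral_comp_eq (mz.pow_const 2).aestronglyMeasurable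
  have iδ : Integrable δ (π.prod X.noiseLaw) := Integrable.of_bound mδ.aestronglyMeasurable D
    (Eventually.of_forall fun p => by rw [Real.norm_of_nonneg (hδ0 p)]; exact hδD p)
  have iV : Integrable V (π.prod X.noiseLaw) := Integrable.of_bound mV.aestronglyMeasurable D
    (Eventually.of_forall fun p => by rw [Real.norm_of_nonneg (hV0 p)]; exact hVD p)
  have iZ : Integrable Z (π.prod X.noiseLaw) :=
    (psnd.integrable_comp mz.aestronglyMeasurable).2 iz
  -- In steady state the mean increment of the `c`-weighted queue vanishes, so lost rate and unused
  -- service together make up for the mean `-ε` of `Z`. The increment is a sum of three terms, each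
  -- at most `D` in absolute value.
  have hδV : ∫ p, δ p ∂(π.prod X.noiseLaw) + ∫ p, V p ∂(π.prod X.noiseLaw) = ε := by
    have h0 := integral_increment_eq_zero X.measurable_step hstat mc (inner_natVec_nonneg hc0)
      (D := 3 * D) (by
        filter_upwards [hZD] with p hp
        have h1 := hstep p
        simp only [Y', Y] at h1
        rw [h1]
        rw [abs_le] at hp ⊢
        have := hδ0 p
        have := hδD p
        have := hV0 p
        have := hVD p
        constructor <;> linarith [hp.1, hp.2])
    have e : ∀ p : (Fin n → ℕ) × (Fin n → ℕ) × 𝒯 × ℝ,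
        ⟪c, natVec (X.step p.1 p.2)⟫ - ⟪c, natVec p.1⟫ = Z p + (δ p + V p) := fun p => by
      have h1 := hstep p
      simp only [Y', Y] at h1
      rw [h1]; ring
    simp_rw [e] at h0
    have iδV : Integrable (fun p => δ p + V p) (π.prod X.noiseLaw) := iδ.add iV
    rw [integral_add iZ iδV, integral_add iδ iV, hZ] at h0
    linarith
  have mw : Measurable fun q : Fin n → ℕ => ‖perp c (natVec q)‖ ^ 2 := measurable_of_countable _
  have me : Measurable fun q : Fin n → ℕ =>
    Complex.exp (Complex.I * (θ * ε * ⟪c, natVec q⟫ : ℝ)) := measurable_of_countable _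
  have main := norm_transform_le (μ := π.prod X.noiseLaw) (y := Y) (y' := Y') (z := Z) (d := δ)
    (v := V) (w := W) (w' := W') (θ := θ) (ε := ε) (D := D) (K := max K₁ (2 * B * K₂)) (M := M)
    hε hD0 hK mY mY' mZ mδ mV (fun p => inner_natVec_nonneg hc0 _)
    (fun p => inner_natVec_nonneg hc0 _) hδ0 hδD hV0 hVD hZD hstep
    (fun p => by
      refine (G.inner_mul_maxRate_sub_le hB hK₂ (hsched p.1 p.2)).trans ?_
      exact mul_le_mul_of_nonneg_right (mul_le_mul_of_nonneg_right (le_max_right _ _)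
        (norm_nonneg _)) (hδ0 p))
    (fun p => by
      refine (inner_next_mul_unused_le hc0 hK₁ p.1 p.2.1 (X.schedule p.1 p.2)).trans ?_
      exact mul_le_mul_of_nonneg_right (mul_le_mul_of_nonneg_right (le_max_left _ _)
        (norm_nonneg _)) (hV0 p))
    ((pfst.integrable_comp mw.aestronglyMeasurable).2 iw)
    ((pstep.integrable_comp mw.aestronglyMeasurable).2 iw)
    ((pfst.integral_comp_eq mw.aestronglyMeasurable).trans_le hw)
    ((pstep.integral_comp_eq mw.aestronglyMeasurable).trans_le hw)
    hZ hδV (indepFun_prod (X := fun q => ⟪c, natVec q⟫) mc mz)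
    ((pstep.integral_comp_eq me.aestronglyMeasurable).trans
      (pfst.integral_comp_eq me.aestronglyMeasurable).symm)
    hθ
  rw [hZ2] at main
  rw [← pfst.integral_comp_eq me.aestronglyMeasurable]
  exact main

end GeneralizedSwitch.MaxWeightSystem

/-! ### Convergence in distribution -/

lemma tendsto_div_of_norm_mul_sub_le {ι : Type*} {l : Filter ι} {g h : ι → ℂ} {k h₀ : ℂ}
    {e : ι → ℝ} (hgh : ∀ᶠ i in l, ‖g i * h i - k‖ ≤ e i) (he : Tendsto e l (𝓝 0))
    (hh : Tendsto h l (𝓝 h₀)) (hh₀ : h₀ ≠ 0) : Tendsto g l (𝓝 (k / h₀)) := by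
  have h1 : Tendsto (fun i => g i * h i) l (𝓝 k) := by
    rw [tendsto_iff_norm_sub_tendsto_zero]
    exact squeeze_zero' (Eventually.of_forall fun _ => norm_nonneg _) hgh he
  refine (h1.div hh hh₀).congr' ?_
  filter_upwards [hh.eventually_ne hh₀] with i hi
  exact mul_div_cancel_right₀ _ hi

lemma norm_exp_I_mul_sub_exp_le (x y : ℝ) :
    ‖Complex.exp (Complex.I * x) - Complex.exp (Complex.I * y)‖ ≤ |x - y| := by
  have e : Complex.exp (Complex.I * x) - Complex.exp (Complex.I * y) =
      Complex.exp (Complex.I * y) * (Complex.exp (Complex.I * (x - y : ℝ)) - 1) := by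
    rw [mul_sub, ← Complex.exp_add, mul_one]
    congr 2; push_cast; ring
  rw [e, norm_mul, Complex.norm_exp_I_mul_ofReal, one_mul]
  exact Real.norm_exp_I_mul_ofReal_sub_one_le

/-- Scaled queue lengths may be replaced by their projections on the line of `c`. -/
lemma norm_integral_exp_sub_le {n : ℕ} {π : Measure (Fin n → ℕ)} [IsProbabilityMeasure π]
    {c : EuclideanSpace ℝ (Fin n)} {M : ℝ}
    (iw : Integrable (fun q => ‖perp c (natVec q)‖ ^ 2) π)
    (hw : ∫ q, ‖perp c (natVec q)‖ ^ 2 ∂π ≤ M) (t : EuclideanSpace ℝ (Fin n)) {ε : ℝ}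
    (hε : 0 < ε) :
    ‖∫ q, Complex.exp (Complex.I * (⟪ε • natVec q, t⟫ : ℝ)) ∂π -
      ∫ q, Complex.exp (Complex.I * (⟪c, t⟫ * ε * ⟪c, natVec q⟫ : ℝ)) ∂π‖ ≤
      ε * ‖t‖ * (1 + M) := by
  have int (f : (Fin n → ℕ) → ℝ) : Integrable (fun q => Complex.exp (Complex.I * (f q : ℝ))) π :=
    Integrable.of_bound (measurable_of_countable _).aestronglyMeasurable 1
      (Eventually.of_forall fun q => (Complex.norm_exp_I_mul_ofReal _).le)
  rw [← integral_sub (int _) (int _)]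
  have ib : Integrable (fun q => ε * ‖t‖ * (1 + ‖perp c (natVec q)‖ ^ 2)) π :=
    ((integrable_const _).add iw).const_mul _
  refine (norm_integral_le_of_norm_le ib (Eventually.of_forall fun q => ?_)).trans ?_
  · refine (norm_exp_I_mul_sub_exp_le _ _).trans ?_
    have e : ⟪ε • natVec q, t⟫ - ⟪c, t⟫ * ε * ⟪c, natVec q⟫ = ε * ⟪perp c (natVec q), t⟫ := by
      rw [perp_inner, real_inner_smul_left]; ring
    rw [e, abs_mul, abs_of_pos hε, mul_assoc]
    refine mul_le_mul_of_nonneg_left ((abs_real_inner_le_norm _ _).trans ?_) hε.le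
    rw [mul_comm]
    refine mul_le_mul_of_nonneg_left ?_ (norm_nonneg t)
    nlinarith [sq_nonneg (‖perp c (natVec q)‖ - 1), norm_nonneg (perp c (natVec q))]
  · rw [integral_const_mul, integral_add (integrable_const _) iw]
    simp only [integral_const, probReal_univ, one_smul]
    gcongr

lemma integrable_and_integral_le_of_lintegral_le {α : Type*} [MeasurableSpace α] {μ : Measure α}
    {f : α → ℝ} (mf : AEStronglyMeasurable f μ) (hf : ∀ x, 0 ≤ f x) {M : ℝ} (hM : 0 ≤ M)
    (h : ∫⁻ x, ENNReal.ofReal (f x) ∂μ ≤ ENNReal.ofReal M) :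
    Integrable f μ ∧ ∫ x, f x ∂μ ≤ M := by
  refine ⟨⟨mf, ?_⟩, ?_⟩
  · rw [hasFiniteIntegral_iff_ofReal (Eventually.of_forall hf)]
    exact h.trans_lt ENNReal.ofReal_lt_top
  · rw [integral_eq_lintegral_of_nonneg_ae (Eventually.of_forall hf) mf]
    exact ENNReal.toReal_le_of_le_ofReal hM h

/-- The **Lévy convergence theorem** along a countably generated filter. -/
lemma tendstoInDistribution_of_tendsto_charFun {ι E Ω' : Type*} {Ω : ι → Type*}
    [∀ i, MeasurableSpace (Ω i)] [MeasurableSpace Ω'] [NormedAddCommGroup E]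
    [InnerProductSpace ℝ E] [FiniteDimensional ℝ E] [MeasurableSpace E] [BorelSpace E]
    {l : Filter ι} [l.IsCountablyGenerated] {μ : (i : ι) → Measure (Ω i)}
    [∀ i, IsProbabilityMeasure (μ i)] {μ' : Measure Ω'} [IsProbabilityMeasure μ']
    {Y : (i : ι) → Ω i → E} {Z : Ω' → E} (hY : ∀ i, AEMeasurable (Y i) (μ i))
    (hZ : AEMeasurable Z μ')
    (h : ∀ t, Tendsto (fun i => charFun ((μ i).map (Y i)) t) l (𝓝 (charFun (μ'.map Z) t))) :
    TendstoInDistribution Y l Z μ μ' where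
  forall_aemeasurable := hY
  aemeasurable_limit := hZ
  -- Along a countably generated filter, convergence can be tested on sequences, where the classical
  -- theorem applies.
  tendsto := tendsto_of_seq_tendsto fun _ hu =>
    ProbabilityMeasure.tendsto_of_tendsto_charFun fun t => (h t).comp hu

theorem theorem3 {n : ℕ} {𝒯 : Type*} [Fintype 𝒯] [MeasurableSpace 𝒯] [DiscreteMeasurableSpace 𝒯]
    (G : GeneralizedSwitch n 𝒯)
    -- a facet of the capacity region and a point in its relative interior
    (c : EuclideanSpace ℝ (Fin n)) (b : ℝ) (hc : IsFacetInequality G.capacityRegion c b)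
    (r : EuclideanSpace ℝ (Fin n))
    (hr : r ∈ intrinsicInterior ℝ (faceOf G.capacityRegion c b))
    -- for each small `ε`, a switch with arrival rate `r - ε c` operating under MaxWeight
    (ε₀ : ℝ) (hε₀ : 0 < ε₀)
    {Ω : Set.Ioo (0 : ℝ) ε₀ → Type*} [∀ ε, MeasurableSpace (Ω ε)]
    (P : (ε : Set.Ioo (0 : ℝ) ε₀) → Measure (Ω ε)) [∀ ε, IsProbabilityMeasure (P ε)]
    (X : (ε : Set.Ioo (0 : ℝ) ε₀) → G.MaxWeightSystem (P ε))
    (Amax : ℕ) (hAmax : ∀ ε k, ∀ᵐ ω ∂(P ε), ∀ i, (X ε).arrival k ω i ≤ Amax)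
    (hmean : ∀ ε i, ∫ ω, ((X ε).arrival 0 ω i : ℝ) ∂(P ε) = r i - (ε : ℝ) * c i)
    -- limits of the covariances of the arrivals
    (Cov : Fin n → Fin n → ℝ)
    (hCov : ∀ i j, Tendsto
      (fun ε => cov[fun ω => ((X ε).arrival 0 ω i : ℝ), fun ω => ((X ε).arrival 0 ω j : ℝ); P ε])
      (comap Subtype.val (𝓝[>] (0 : ℝ))) (𝓝 (Cov i j)))
    -- the steady-state vectors
    {Ω' : Set.Ioo (0 : ℝ) ε₀ → Type*} [∀ ε, MeasurableSpace (Ω' ε)]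
    (P' : (ε : Set.Ioo (0 : ℝ) ε₀) → Measure (Ω' ε)) [∀ ε, IsProbabilityMeasure (P' ε)]
    (qbar : (ε : Set.Ioo (0 : ℝ) ε₀) → Ω' ε → Fin n → ℕ)
    (hqbar : ∀ ε, TendstoInDistribution (X ε).queue atTop (qbar ε) (fun _ => P ε) (P' ε))
    -- the exponential random variable
    {Ω₀ : Type*} [MeasurableSpace Ω₀] (P₀ : Measure Ω₀) [IsProbabilityMeasure P₀] (Υ : Ω₀ → ℝ)
    (hΥ : HasLaw Υ (exponentialWithMean
      ((∑ i, ∑ j, c i * c j * Cov i j + G.maxRateVariance c) / 2)) P₀) :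
    TendstoInDistribution (fun (ε : Set.Ioo (0 : ℝ) ε₀) ω => (ε : ℝ) • natVec (qbar ε ω))
      (comap Subtype.val (𝓝[>] (0 : ℝ))) (fun ω => Υ ω • c) P' P₀ := by
  obtain ⟨B, hB⟩ := G.exists_forall_le fun _ s => ‖natVec s‖
  obtain ⟨K₂, hK₂⟩ := G.exists_forall_le fun t s => (G.maxRate c t - ⟪c, natVec s⟫)⁻¹
  obtain ⟨K₁, hK₁⟩ := (Set.finite_range fun i => (c i)⁻¹).bddAbove
  replace hK₁ : ∀ i, (c i)⁻¹ ≤ K₁ := fun i => hK₁ ⟨i, rfl⟩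
  obtain ⟨δ, hδ, hr'⟩ := G.exists_inner_add_le_meanMaxRate hc hr
  have hrF := intrinsicInterior_subset hr
  have hb : G.meanMaxRate c = ⟪c, r⟫ := (G.meanMaxRate_eq hc hrF).trans hrF.2.symm
  have hn := hc.norm_eq_one
  set D : ℝ := ‖natVec (fun _ : Fin n => Amax)‖ + 2 * B with hD
  -- Like `D`, `K₁`, `K₂` and `δ`, this constant depends only on the region, the facet point and
  -- `Amax`, not on ε.
  set M : ℝ := 2 * D ^ 4 + (10 * D ^ 2 + 1) * ((10 * D ^ 2 + 1) / (4 * δ)) ^ 2 with hM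
  have hM0 : 0 ≤ M := by positivity
  let π (ε : Set.Ioo (0 : ℝ) ε₀) : Measure (Fin n → ℕ) := (P' ε).map (qbar ε)
  have hq (ε) : AEMeasurable (qbar ε) (P' ε) := (hqbar ε).aemeasurable_limit
  have hπ (ε) : IsProbabilityMeasure (π ε) := Measure.isProbabilityMeasure_map (hq ε)
  have hstat (ε) : ((π ε).prod (X ε).noiseLaw).map (fun p => (X ε).step p.1 p.2) = π ε :=
    (X ε).stationary (hqbar ε)
  have hw (ε) : Integrable (fun q => ‖perp c (natVec q)‖ ^ 2) (π ε) ∧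
      ∫ q, ‖perp c (natVec q)‖ ^ 2 ∂(π ε) ≤ M :=
    integrable_and_integral_le_of_lintegral_le (measurable_of_countable _).aestronglyMeasurable
      (fun q => sq_nonneg _) hM0
      ((X ε).lintegral_norm_perp_sq_le (hAmax ε 0) hn hc.nonneg hδ (hmean ε) hb hr' hB le_rfl
        (hstat ε))
  set l : Filter (Set.Ioo (0 : ℝ) ε₀) := comap Subtype.val (𝓝[>] (0 : ℝ)) with hl
  have hl0 : Tendsto (fun ε : Set.Ioo (0 : ℝ) ε₀ => (ε : ℝ)) l (𝓝 0) :=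
    tendsto_comap.mono_right nhdsWithin_le_nhds
  -- Needed to pass the nonnegativity of the variances to their limit.
  have : l.NeBot := NeBot.comap_of_range_mem inferInstance (by
    rw [Subtype.range_coe]; exact Ioo_mem_nhdsGT hε₀)
  set S : Set.Ioo (0 : ℝ) ε₀ → ℝ := fun ε => ∑ i, ∑ j, c i * c j *
    cov[fun ω => ((X ε).arrival 0 ω i : ℝ), fun ω => ((X ε).arrival 0 ω j : ℝ); P ε] with hS
  set S₀ : ℝ := ∑ i, ∑ j, c i * c j * Cov i j with hS₀
  set v : ℝ := G.maxRateVariance c with hv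
  have hSlim : Tendsto S l (𝓝 S₀) :=
    tendsto_finsetSum _ fun i _ => tendsto_finsetSum _ fun j _ => (hCov i j).const_mul _
  have hm : 0 ≤ (S₀ + v) / 2 := by
    have h1 : 0 ≤ S₀ := ge_of_tendsto' hSlim fun ε => by
      rw [hS]
      simp only [← (X ε).variance_inner_arrival (hAmax ε 0) c]
      exact variance_nonneg _ _
    have h2 : 0 ≤ v := variance_nonneg _ _
    positivity
  have mε (ε : Set.Ioo (0 : ℝ) ε₀) :
      Measurable fun q : Fin n → ℕ => (ε : ℝ) • natVec q := measurable_of_countable _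
  refine tendstoInDistribution_of_tendsto_charFun (fun ε => (mε ε).comp_aemeasurable (hq ε))
    (hΥ.aemeasurable.smul_const c) fun t => ?_
  set θ : ℝ := ⟪c, t⟫ with hθ
  have lhs (ε : Set.Ioo (0 : ℝ) ε₀) :
      charFun ((P' ε).map fun ω => (ε : ℝ) • natVec (qbar ε ω)) t =
        ∫ q, Complex.exp (Complex.I * (⟪(ε : ℝ) • natVec q, t⟫ : ℝ)) ∂(π ε) := by
    have e : (P' ε).map (fun ω => (ε : ℝ) • natVec (qbar ε ω)) =
        (π ε).map (fun q => (ε : ℝ) • natVec q) :=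
      (AEMeasurable.map_map_of_aemeasurable (mε ε).aemeasurable (hq ε)).symm
    rw [e, charFun_apply, integral_map (mε ε).aemeasurable (by fun_prop)]
    simp only [mul_comm]
  have rhs : charFun (P₀.map fun ω => Υ ω • c) t =
      ∫ x, Complex.exp (Complex.I * (θ * x : ℝ)) ∂(exponentialWithMean ((S₀ + v) / 2)) := by
    rw [charFun_apply, integral_map (hΥ.aemeasurable.smul_const c) (by fun_prop), ← hΥ.map_eq,
      integral_map hΥ.aemeasurable (by fun_prop)]
    simp only [real_inner_smul_left, ← hθ, mul_comm]
  have hprob : IsProbabilityMeasure (exponentialWithMean ((S₀ + v) / 2)) := by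
    rw [← hΥ.map_eq]; exact Measure.isProbabilityMeasure_map hΥ.aemeasurable
  have hproj : Tendsto (fun ε : Set.Ioo (0 : ℝ) ε₀ =>
      ∫ q, Complex.exp (Complex.I * (θ * ε * ⟪c, natVec q⟫ : ℝ)) ∂(π ε)) l
      (𝓝 (∫ x, Complex.exp (Complex.I * (θ * x : ℝ)) ∂(exponentialWithMean ((S₀ + v) / 2)))) := by
    rcases eq_or_ne θ 0 with h0 | h0
    -- For `θ = 0` the transform equation is empty, but both characteristic functions equal 1.
    · simp [h0]
    rw [integral_exp_exponentialWithMean hm h0]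
    have hsmall : ∀ᶠ ε : Set.Ioo (0 : ℝ) ε₀ in l, |θ * ε| * (2 * D) ≤ 1 := by
      have : Tendsto (fun ε : Set.Ioo (0 : ℝ) ε₀ => |θ * ε| * (2 * D)) l
          (𝓝 (|θ * 0| * (2 * D))) := ((hl0.const_mul θ).abs).mul_const _
      exact (this.eventually_lt_const (by simp)).mono fun _ h => h.le
    refine tendsto_div_of_norm_mul_sub_le (hsmall.mono fun ε hε =>
      (X ε).norm_transform_queue_le (hAmax ε 0) hn hc.nonneg ε.2.1 (hmean ε) hb hB le_rfl hK₁ hK₂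
        (hstat ε) (hw ε).1 (hw ε).2 hε) ?_ ?_ ?_
    · have hsq : Tendsto (fun ε : Set.Ioo (0 : ℝ) ε₀ => √(ε : ℝ)) l (𝓝 0) := by
        simpa using hl0.sqrt
      have := ((((hsq.const_mul (max K₁ (2 * B * K₂) * (1 + 2 * M * D))).add
        (hl0.const_mul (2 * D))).const_mul (θ ^ 2)).add (hl0.const_mul (8 * |θ| ^ 3 * D ^ 3)))
      simpa using this
    · have h1 : Tendsto (fun ε : Set.Ioo (0 : ℝ) ε₀ => S ε + v + (ε : ℝ) ^ 2) l
          (𝓝 (S₀ + v + 0 ^ 2)) := (hSlim.add_const v).add (hl0.pow 2)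
      have h2 := ((((Complex.continuous_ofReal.tendsto _).comp h1).const_mul
        ((θ : ℂ) ^ 2 / 2)).const_add (Complex.I * θ))
      have h3 (a : ℝ) : Complex.I * θ + (θ : ℂ) ^ 2 * ((a / 2 : ℝ) : ℂ) =
          Complex.I * θ + (θ : ℂ) ^ 2 / 2 * ((a + 0 ^ 2 : ℝ) : ℂ) := by push_cast; ring
      rw [h3]
      exact h2
    · intro h
      have := congrArg Complex.im h
      simp [← Complex.ofReal_pow, h0] at this
  rw [rhs]
  have herr : Tendsto (fun ε : Set.Ioo (0 : ℝ) ε₀ =>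
      charFun ((P' ε).map fun ω => (ε : ℝ) • natVec (qbar ε ω)) t -
        ∫ q, Complex.exp (Complex.I * (θ * ε * ⟪c, natVec q⟫ : ℝ)) ∂(π ε)) l (𝓝 0) := by
    rw [tendsto_zero_iff_norm_tendsto_zero]
    refine squeeze_zero (fun _ => norm_nonneg _) (g := fun ε : Set.Ioo (0 : ℝ) ε₀ => (ε : ℝ) * ‖t‖ * (1 + M))
      (fun ε => ?_) ?_
    · rw [lhs]
      exact norm_integral_exp_sub_le (hw ε).1 (hw ε).2 t ε.2.1
    · simpa using (hl0.mul_const ‖t‖).mul_const (1 + M)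
  simpa using herr.add hproj
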